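/- Let $d,T\ge 1$ be integers, and let $F:\mathbb{R}^d\to\mathbb{R}$ be differentiable and bounded below by $F^*\in\mathbb{R}$. Write $\partial_jF$ for $\partial F/\partial x_j$, and $\|\cdot\|_1,\|\cdot\|_2,\|\cdot\|_\infty$ for the usual norms on $\mathbb{R}^d$. Let $L_0,L_1\in\mathbb{R}^d$ with $L_0\ne 0$, and suppose that $F$ is coordinate-wise $(L_0,L_1)$-smooth: for all $x,y\in\mathbb{R}^d$ with $\|x-y\|_2\le 1/\|L_1\|_\infty$ (for all $x,y$ if $L_1=0$) and all $j\in[d]=\{1,\dots,d\}$, $$|\partial_jF(y)-\partial_jF(x)|\le\Big(\frac{L_{0,j}}{\sqrt d}+L_{1,j}|\partial_jF(x)|\Big)\|y-x\|_2 .$$ Let $\xi_1,\xi_2,\dots$ be independent samples from a probability distribution $\mathcal D$, and let $\nabla f(x,\xi)$ be a stochastic gradient, jointly measurable in $(x,\xi)$, with $\mathbb{E}_{\xi\sim\mathcal D}[\nabla f(x,\xi)]=\nabla F(x)$ for all $x$. Let $\sigma\in\mathbb{R}^d$ have entries $\sigma_j>0$, and suppose that for all $x$ and $j$, $|\nabla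 f(x,\xi)_j-\partial_jF(x)|\le\sigma_j$ with probability $1$ for $\xi\sim\mathcal D$. Generalized SignSGD with inputs $x_1\in\mathbb{R}^d$, $\beta_1,\beta_2,\eta$ sets $m_0=v_0=0$ and iterates, coordinate-wise, for $t=1,\dots,T$, $$g_t=\nabla f(x_t,\xi_t),\quad m_t=\beta_1m_{t-1}+(1-\beta_1)g_t,\quad v_t=\beta_2v_{t-1}+(1-\beta_2)m_t^2,\quad x_{t+1}=x_t-\eta\frac{m_t}{\sqrt{v_t}},$$ where $0/0$ is read as $0$. Let $\Delta$ be any upper bound on $F(x_1)-F^*$, let $0<\delta<1$, and put $$\alpha=\min\Big(\frac{\sqrt{\|L_0\|_1}\sqrt\Delta}{\|\sigma\|_1\sqrt T},1\Big),\quad \beta_1=1-\alpha,\quad \eta=\frac{\sqrt{\Delta\alpha}}{\sqrt{\|L_0\|_1}\sqrt T}.$$ Let $\beta_2\ge0$ satisfy $\sqrt{\beta_2}/\beta_1<1$, and put $\rho=1-\sqrt{\beta_2}/\beta_1$; if $\beta_1=0$, this means $\beta_2=0$ and $\rho=1$. Suppose that $$T\ge\max\Big(\frac{100\,d\,\Delta\|L_1\|_\infty^2}{(1-\beta_2)\rho^2\|L_0\|_1},\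 \frac{10000\,d^2\Delta\|\sigma\|_1^2\|L_1\|_\infty^4}{(1-\beta_2)^2\rho^4\|L_0\|_1^3}\Big).$$ In the bounds below, $\mathcal O$ hides only a universal constant; the exponential is read as $0$ if $L_1=0$; and if $\Delta=0$ (in which case $\nabla F(x_1)=0$ and all iterates equal $x_1$), a quotient with denominator $0$ is read as $0$. (1) If $M_j:=\sup\{|\partial_jF(x)|:F(x)\le F(x_1)\}$ is finite for every $j\in[d]$, and $M=(M_1,\dots,M_d)$, then with probability at least $1-\delta$, $$\begin{aligned}\min_{t\in[T]}\|\nabla F(x_t)\|_1=\ &\mathcal O\Big(\frac{\sqrt{\log(dT/\delta)}\,\|L_0\|_1^{1/4}\Delta^{1/4}\|\sigma\|_1^{1/2}}{\rho\sqrt{1-\beta_2}\,T^{1/4}}+\frac{\log(dT/\delta)\sqrt{\|L_0\|_1\Delta}}{\rho\sqrt T}\Big)\\&+\mathcal O\Big(\frac{\|M\|_1+\|\sigma\|_1}{\rho}\exp\Big(-\frac{\sqrt{1-\beta_2}\,\|L_0\|_1^{3/4}}{\sqrt d\,\|L_1\|_\infty\|\sigma\|_1^{1/2}\Delta^{1/4}}T^{1/4}\Big)\Big)+\mathcal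 O\Big(\frac{\|\nabla F(x_1)\|_1}{T}\Big).\end{aligned}$$ (2) If $\beta_2=0$ then, without any assumption on the $M_j$, with probability at least $1-\delta$, $$\begin{aligned}\min_{t\in[T]}\|\nabla F(x_t)\|_1=\ &\mathcal O\Big(\frac{\sqrt{\log(dT/\delta)}\,\|L_0\|_1^{1/4}\Delta^{1/4}\|\sigma\|_1^{1/2}}{T^{1/4}}+\frac{\log(dT/\delta)\sqrt{\|L_0\|_1\Delta}}{\sqrt T}\Big)\\&+\mathcal O\Big(\frac{\|\nabla F(x_1)\|_1}{\sqrt T}\Big(\frac1{\sqrt T}+\frac{\|\sigma\|_1}{\sqrt{\|L_0\|_1\Delta}}\Big)+\frac{\|\sigma\|_1}{T}\Big).\end{aligned}$$ -/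

import Mathlib

open MeasureTheory ProbabilityTheory

/-- The `ℓ¹` norm `∑ j, |v j|` of a vector. -/
def l1Norm {d : ℕ} (v : Fin d → ℝ) : ℝ := ∑ j, |v j|

/-- The `ℓ^∞` norm `max j, |v j|` of a vector (it is `0` in dimension `0`). -/
noncomputable def linfNorm {d : ℕ} (v : Fin d → ℝ) : ℝ := ⨆ j, |v j|

/-- The partial derivative `∂F/∂x_j (x)`, i.e. the `j`-th coordinate of the gradient. -/
noncomputable def partialD {d : ℕ} (F : EuclideanSpace ℝ (Fin d) → ℝ)
    (j : Fin d) (x : EuclideanSpace ℝ (Fin d)) : ℝ :=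
  (gradient F x) j

/-- The `ℓ¹` norm `‖∇F(x)‖₁` of the gradient. -/
noncomputable def gradL1 {d : ℕ} (F : EuclideanSpace ℝ (Fin d) → ℝ)
    (x : EuclideanSpace ℝ (Fin d)) : ℝ :=
  l1Norm fun j => partialD F j x

/-- Coordinate-wise `(L₀, L₁)`-smoothness.  The condition `‖x - y‖₂ ≤ 1 / ‖L₁‖_∞` is written
`‖L₁‖_∞ * ‖x - y‖₂ ≤ 1`, so that it is no restriction (`1 / 0 = ∞`) when `L₁ = 0`. -/
def CoordSmooth {d : ℕ} (F : EuclideanSpace ℝ (Fin d) → ℝ) (L₀ L₁ : Fin d → ℝ) : Prop :=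
  Differentiable ℝ F ∧
    ∀ x y : EuclideanSpace ℝ (Fin d), linfNorm L₁ * ‖x - y‖ ≤ 1 → ∀ j : Fin d,
      |partialD F j y - partialD F j x| ≤
        (L₀ j / Real.sqrt d + L₁ j * |partialD F j x|) * ‖y - x‖

/-- The state of the generalized SignSGD algorithm: the current point, the momentum and the
second moment. -/
structure SignSGDState (d : ℕ) where
  x : EuclideanSpace ℝ (Fin d)
  m : Fin d → ℝ
  v : Fin d → ℝ

/-- One step of generalized SignSGD with stochastic gradient `g`; all operations are
coordinate-wise.  If `v j = 0` then the new `m j` is `0` too (for `β₂ < 1`), and the quotient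
`0 / 0` is `0`, so that this coordinate does not move (the convention `sign 0 = 0`). -/
noncomputable def signSGDStep {d : ℕ} (β₁ β₂ η : ℝ) (s : SignSGDState d)
    (g : EuclideanSpace ℝ (Fin d)) : SignSGDState d :=
  let m : Fin d → ℝ := fun j => β₁ * s.m j + (1 - β₁) * g j
  let v : Fin d → ℝ := fun j => β₂ * s.v j + (1 - β₂) * m j ^ 2
  { x := WithLp.toLp 2 fun j => s.x j - η * (m j / Real.sqrt (v j))
    m := m
    v := v }

/-- The state `(x_{t+1}, m_t, v_t)` after `t` steps, started at `x₁` with `m_0 = v_0 = 0`.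
Step `t` uses the stochastic gradient `gradf x_t ξ_t`. -/
noncomputable def signSGDState {d : ℕ} {Ξ : Type*}
    (gradf : EuclideanSpace ℝ (Fin d) → Ξ → EuclideanSpace ℝ (Fin d))
    (x₁ : EuclideanSpace ℝ (Fin d)) (β₁ β₂ η : ℝ) (ξ : ℕ → Ξ) : ℕ → SignSGDState d
  | 0 => { x := x₁, m := 0, v := 0 }
  | t + 1 =>
    let s := signSGDState gradf x₁ β₁ β₂ η ξ t
    signSGDStep β₁ β₂ η s (gradf s.x (ξ (t + 1)))

/-- The iterate `x_t` of generalized SignSGD, for `t ≥ 1`. -/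
noncomputable def signSGDIterate {d : ℕ} {Ξ : Type*}
    (gradf : EuclideanSpace ℝ (Fin d) → Ξ → EuclideanSpace ℝ (Fin d))
    (x₁ : EuclideanSpace ℝ (Fin d)) (β₁ β₂ η : ℝ) (ξ : ℕ → Ξ) (t : ℕ) :
    EuclideanSpace ℝ (Fin d) :=
  (signSGDState gradf x₁ β₁ β₂ η ξ (t - 1)).x

/-- The set of the values `|∂F/∂x_j (x)|` over the sublevel set `F x ≤ F x₁`. -/
def sublevelPartials {d : ℕ} (F : EuclideanSpace ℝ (Fin d) → ℝ)
    (x₁ : EuclideanSpace ℝ (Fin d)) (j : Fin d) : Set ℝ :=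
  {r | ∃ x, F x ≤ F x₁ ∧ r = |partialD F j x|}

/-- `exp (- √(1-β₂) ‖L₀‖₁^{3/4} / (√d ‖L₁‖_∞ ‖σ‖₁^{1/2} Δ^{1/4}) * T^{1/4})`, read as
`exp (-∞) = 0` when `‖L₁‖_∞ = 0`. -/
noncomputable def decayFactor {d : ℕ} (L₀ L₁ σ : Fin d → ℝ) (Δ β₂ : ℝ) (T : ℕ) : ℝ :=
  if linfNorm L₁ = 0 then 0
  else Real.exp (-(Real.sqrt (1 - β₂) * l1Norm L₀ ^ (3 / 4 : ℝ) /
    (Real.sqrt d * linfNorm L₁ * l1Norm σ ^ (1 / 2 : ℝ) * Δ ^ (1 / 4 : ℝ))) *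
      (T : ℝ) ^ (1 / 4 : ℝ))

/-! Write `α = 1 - β₁`, `c = √(1 - β₂)`, `D = ∂_j F(x_t)`. Subtracting from the momentum the same
exponential average of the gradient noise leaves a noise-free average of past partial derivatives.
Since `v_t ≥ (1 - β₂) m_t²`, each coordinate moves by at most `η / c`, so smoothness bounds how far
this average lags behind `D` (`abs_momentum_sub_le`). Smoothness is anchored at the newer point, so
the part of the lag due to `L₁` is proportional to the current `|D|`; the lower bound on `T` makes
it at most `ρ|D| / 5`, and it is absorbed. What remains is an error `E`: a decaying multiple of the
initial gradient, a term from `L₀`, and the noise.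

Slow variation also gives `√v_t ≤ (c / ρ)(2|D| + E)` (`sqrt_secondMoment_le`), the factor `1 / ρ`
being a geometric series of ratio `√β₂ / β₁ = 1 - ρ`. Hence a normalized step gains at least `(ρ|D|
/ 8 - 4E) / c` (`normalized_gain`), and telescoping the descent inequality yields a pathwise bound
on the smallest gradient in terms of the noise (`CoordSmooth.exists_gradL1_le`).

The averaged noise in coordinate `j` is sub-Gaussian with variance proxy `σ_j² α`: Hoeffding's lemma
is applied conditionally on the past, then Chernoff and a union bound over `d T` events
(`measure_momentumNoise_le`).

With the prescribed `α` and `η`, every error is of order `R = √(‖L₀‖₁ Δ) / √(α T)`, up to factors of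
`c` and the logarithm. This includes the initial gradient: a sign step from `x₁` cannot go below
`F*`, which bounds `‖∇F(x₁)‖₁` by the gap (`CoordSmooth.gradL1_le`). So for `T ≥ 2` the two leading
terms suffice in both bounds; for `T = 1`, where the logarithm can be arbitrarily small, the term in
`‖∇F(x₁)‖₁` does. -/

/-! ### The momentum recursion in one coordinate -/

/-- The momentum minus its noise part tracks a slowly varying sequence `D`. -/
theorem abs_momentum_sub_le {D p : ℕ → ℝ} {α h l Λ κ : ℝ} (hα₀ : 0 ≤ α) (hα₁ : α ≤ 1)
    (hh : 0 ≤ h) (hl : 0 ≤ l) (hΛ : 0 ≤ Λ) (hκ : 0 ≤ κ) (hκh : α * κ = 2 * h)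
    (hΛh : Λ * h ≤ α / 10) (hp₀ : p 0 = 0)
    (hp : ∀ t, p (t + 1) = (1 - α) * p t + α * D t)
    (hD : ∀ t, |D t - D (t + 1)| ≤ (l + Λ * |D (t + 1)|) * h) (t : ℕ) :
    |p (t + 1) - D t| ≤ (1 - α) ^ (t + 1) * |D 0| + κ * (l + Λ * |D t|) := by
  have hβ : 0 ≤ 1 - α := by linarith
  induction t with
  | zero =>
    have : p (0 + 1) - D 0 = -((1 - α) * D 0) := by rw [hp, hp₀]; ring
    rw [this, abs_neg, abs_mul, abs_of_nonneg hβ, zero_add, pow_one]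
    have : 0 ≤ κ * (l + Λ * |D 0|) := by positivity
    linarith
  | succ t ih =>
    -- Old error and new drift are both contracted by `1 - α`, so constant drifts would sum to about
    -- `h / α`. Taking `α * κ = 2 * h` leaves room for replacing `|D t|` by `|D (t + 1)|` in the
    -- weight, which costs a factor `1 + α / 10`.
    have e : p (t + 1 + 1) - D (t + 1) = (1 - α) * ((p (t + 1) - D t) + (D t - D (t + 1))) := by
      rw [hp (t + 1)]; ring
    have hW : |D t| ≤ |D (t + 1)| + (l + Λ * |D (t + 1)|) * h := by
      have := abs_sub_abs_le_abs_sub (D t) (D (t + 1))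
      linarith [hD t]
    set W := l + Λ * |D (t + 1)| with hWdef
    have hW₀ : 0 ≤ W := by positivity
    have hWt : l + Λ * |D t| ≤ (1 + α / 10) * W := by
      have h1 := mul_le_mul_of_nonneg_left hW hΛ
      have h2 := mul_le_mul_of_nonneg_right hΛh hW₀
      nlinarith
    have hκW : κ * (l + Λ * |D t|) ≤ κ * ((1 + α / 10) * W) :=
      mul_le_mul_of_nonneg_left hWt hκ
    have key : (1 - α) * (κ * ((1 + α / 10) * W) + W * h) ≤ κ * W := by
      have h2 : (1 - α) * (κ * (1 + α / 10) + h) ≤ κ := by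
        have : (1 - α) * (κ * (1 + α / 10) + h)
            = κ - (9 / 10) * (α * κ) - (α * κ) * (α / 10) + (1 - α) * h := by ring
        rw [this, hκh]
        have : 0 ≤ h * α := by positivity
        linarith
      calc _ = ((1 - α) * (κ * (1 + α / 10) + h)) * W := by ring
        _ ≤ κ * W := mul_le_mul_of_nonneg_right h2 hW₀
    rw [e, abs_mul, abs_of_nonneg hβ]
    calc (1 - α) * |p (t + 1) - D t + (D t - D (t + 1))|
        ≤ (1 - α) * (((1 - α) ^ (t + 1) * |D 0| + κ * ((1 + α / 10) * W)) + W * h) := by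
          refine mul_le_mul_of_nonneg_left ((abs_add_le _ _).trans ?_) hβ
          linarith [hD t]
      _ = (1 - α) ^ (t + 1 + 1) * |D 0| + (1 - α) * (κ * ((1 + α / 10) * W) + W * h) := by ring
      _ ≤ _ := by linarith

/-- The second moment is controlled by the tracked sequence. -/
theorem sqrt_secondMoment_le {D m v E : ℕ → ℝ} {T : ℕ} {α β₂ ρ h l Λ κ N : ℝ} (hα₀ : 0 ≤ α)
    (hα₁ : α ≤ 1) (hh : 0 ≤ h) (hl : 0 ≤ l) (hκh : α * κ = 2 * h)
    (hΛh : Λ * h ≤ α / 10) (hβ₂ : 0 ≤ β₂) (hβ₂' : β₂ ≤ 1) (hρ₀ : 0 < ρ) (hρ₁ : ρ ≤ 1)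
    (hρ : Real.sqrt β₂ = (1 - α) * (1 - ρ)) (hN : 0 ≤ N)
    (hE : ∀ t, E t = (1 - α) ^ (t + 1) * |D 0| + κ * l + N)
    (hv₀ : v 0 = 0) (hv : ∀ t, v (t + 1) = β₂ * v t + (1 - β₂) * m (t + 1) ^ 2)
    (hD : ∀ t, |D t - D (t + 1)| ≤ (l + Λ * |D (t + 1)|) * h)
    (hm : ∀ t < T, |m (t + 1) - D t| ≤ E t + |D t| / 5) (t : ℕ) (ht : t < T) :
    Real.sqrt (v (t + 1)) ≤ Real.sqrt (1 - β₂) / ρ * (2 * |D t| + E t) := by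
  have hβ : 0 ≤ 1 - α := by linarith
  have hc : 0 ≤ Real.sqrt (1 - β₂) := Real.sqrt_nonneg _
  have hv_nn : ∀ t, 0 ≤ v t := by
    intro t
    induction t with
    | zero => rw [hv₀]
    | succ t ih => rw [hv]; have : 0 ≤ 1 - β₂ := by linarith
                   positivity
  -- Subadditivity of the square root turns the recursion for `v` into a linear one for `√v`.
  have hstep : ∀ t, Real.sqrt (v (t + 1)) ≤
      Real.sqrt β₂ * Real.sqrt (v t) + Real.sqrt (1 - β₂) * |m (t + 1)| := by
    intro t
    refine Real.sqrt_le_iff.2 ⟨by positivity, ?_⟩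
    rw [hv]
    have h1 := Real.sq_sqrt hβ₂
    have h2 := Real.sq_sqrt (hv_nn t)
    have h3 := Real.sq_sqrt (show 0 ≤ 1 - β₂ by linarith)
    have h4 := sq_abs (m (t + 1))
    have : 0 ≤ (Real.sqrt β₂ * Real.sqrt (v t)) * (Real.sqrt (1 - β₂) * |m (t + 1)|) := by
      positivity
    calc β₂ * v t + (1 - β₂) * m (t + 1) ^ 2
        = (Real.sqrt β₂ * Real.sqrt (v t)) ^ 2 + (Real.sqrt (1 - β₂) * |m (t + 1)|) ^ 2 := by
          rw [mul_pow, mul_pow, h1, h2, h3, h4]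
      _ ≤ _ := by nlinarith
  have hmU : ∀ t < T, |m (t + 1)| ≤ 2 * |D t| + E t := by
    intro t ht
    have h1 := abs_sub_abs_le_abs_sub (m (t + 1)) (D t)
    have := abs_nonneg (D t)
    linarith [hm t ht]
  have hmul : ∀ t < T, Real.sqrt (1 - β₂) * |m (t + 1)| ≤
      Real.sqrt (1 - β₂) * (2 * |D t| + E t) := fun t ht ↦
    mul_le_mul_of_nonneg_left (hmU t ht) hc
  induction t with
  | zero =>
    have h1 := hstep 0
    rw [hv₀, Real.sqrt_zero, mul_zero, zero_add, zero_add] at h1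
    rw [zero_add]
    have h2 := hmul 0 ht
    rw [zero_add] at h2
    refine (h1.trans h2).trans ?_
    refine mul_le_mul_of_nonneg_right ?_ ((abs_nonneg _).trans (hmU 0 ht))
    exact le_div_self hc hρ₀ hρ₁
  | succ t ih =>
    have ih := ih (by omega)
    -- The envelope `2|D| + E` loses at most a factor `1 - α` per step: the drift `2 * l * h` is
    -- paid by the `α * κ * l` that `E` gives up. As `√β₂ = (1 - α)(1 - ρ)`, older contributions are
    -- then discounted by `1 - ρ` per step.
    have hU : (1 - α) * (2 * |D t| + E t) ≤ 2 * |D (t + 1)| + E (t + 1) := by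
      have hW : |D t| ≤ |D (t + 1)| + (l + Λ * |D (t + 1)|) * h := by
        have := abs_sub_abs_le_abs_sub (D t) (D (t + 1))
        linarith [hD t]
      have h1 : (1 - α) * |D t| ≤ (1 - α) * (|D (t + 1)| + l * h + α / 10 * |D (t + 1)|) := by
        refine mul_le_mul_of_nonneg_left ?_ hβ
        have := mul_le_mul_of_nonneg_right hΛh (abs_nonneg (D (t + 1)))
        linarith
      rw [hE, hE]
      have h2 : 0 ≤ α * |D (t + 1)| := by positivity
      have h3 : 0 ≤ α * N := by positivity
      have h4 : 0 ≤ α * (α * |D (t + 1)|) := by positivity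
      have h5 : 0 ≤ α * (l * h) := by positivity
      have h6 : (1 - α) * (κ * l) = κ * l - 2 * h * l := by rw [← hκh]; ring
      have h7 : (1 - α) * ((1 - α) ^ (t + 1) * |D 0|) = (1 - α) ^ (t + 1 + 1) * |D 0| := by ring
      nlinarith
    calc Real.sqrt (v (t + 1 + 1))
        ≤ Real.sqrt β₂ * Real.sqrt (v (t + 1)) + Real.sqrt (1 - β₂) * |m (t + 1 + 1)| :=
          hstep _
      _ ≤ Real.sqrt β₂ * (Real.sqrt (1 - β₂) / ρ * (2 * |D t| + E t)) +
          Real.sqrt (1 - β₂) * (2 * |D (t + 1)| + E (t + 1)) :=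
          add_le_add (mul_le_mul_of_nonneg_left ih (Real.sqrt_nonneg _)) (hmul _ ht)
      _ = (1 - ρ) * (Real.sqrt (1 - β₂) / ρ) * ((1 - α) * (2 * |D t| + E t)) +
          Real.sqrt (1 - β₂) * (2 * |D (t + 1)| + E (t + 1)) := by rw [hρ]; ring
      _ ≤ (1 - ρ) * (Real.sqrt (1 - β₂) / ρ) * (2 * |D (t + 1)| + E (t + 1)) +
          Real.sqrt (1 - β₂) * (2 * |D (t + 1)| + E (t + 1)) := by
          have : 0 ≤ (1 - ρ) * (Real.sqrt (1 - β₂) / ρ) :=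
            mul_nonneg (by linarith) (div_nonneg hc hρ₀.le)
          linarith [mul_le_mul_of_nonneg_left hU this]
      _ = Real.sqrt (1 - β₂) / ρ * (2 * |D (t + 1)| + E (t + 1)) := by
          field_simp
          ring

/-- The gain of a normalized step, in terms of the error `E` of the momentum. -/
theorem normalized_gain {D m s E c ρ : ℝ} (hc : 0 < c) (hρ₀ : 0 < ρ) (hρ₁ : ρ ≤ 1) (hE : 0 ≤ E)
    (hm : |m - D| ≤ E + |D| / 5) (hs : s ≤ c / ρ * (2 * |D| + E)) (hs' : c * |m| ≤ s) :
    1 / c * (ρ / 8 * |D| - 4 * E) ≤ D * (m / s) := by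
  have hD := abs_nonneg D
  have hρD : ρ * |D| ≤ |D| := by nlinarith
  have hratio : |m / s| ≤ 1 / c := by
    rw [abs_div]
    rcases eq_or_ne s 0 with h | h
    · rw [h, abs_zero, div_zero]; positivity
    · have : 0 < s := lt_of_le_of_ne ((by positivity : 0 ≤ c * |m|).trans hs') h.symm
      rw [abs_of_pos this, div_le_div_iff₀ this hc]
      linarith
  -- If the momentum is off by half of `|D|`, then `E ≥ 3|D| / 10`, and the trivial bound `|m / s| ≤
  -- 1 / c` suffices. Otherwise `D * m ≥ |D|² / 2`, and only the upper bound on `s` is needed.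
  by_cases hbig : |D| / 2 ≤ |m - D|
  · have h2 : -(|D| * (1 / c)) ≤ D * (m / s) := by
      have := neg_abs_le (D * (m / s))
      rw [abs_mul] at this
      linarith [mul_le_mul_of_nonneg_left hratio hD]
    have h3 : 1 / c * (ρ / 8 * |D| - 4 * E) ≤ 1 / c * (-|D|) :=
      mul_le_mul_of_nonneg_left (by linarith) (by positivity)
    linarith
  · push Not at hbig
    have hDne : D ≠ 0 := by
      rintro rfl
      simp only [abs_zero, zero_div] at hbig
      exact absurd hbig (not_lt.2 (abs_nonneg _))
    have hD' : 0 < |D| := abs_pos.2 hDne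
    have hDm : |D| ^ 2 / 2 ≤ D * m := by
      have h1 : D * m = D ^ 2 + D * (m - D) := by ring
      have h2 := neg_abs_le (D * (m - D))
      rw [abs_mul] at h2
      have h3 := mul_le_mul_of_nonneg_left hbig.le hD
      rw [h1, ← sq_abs D]
      linarith
    have hm0 : 0 < |m| := by
      refine abs_pos.2 fun h ↦ ?_
      rw [h, mul_zero] at hDm
      have : 0 < |D| ^ 2 := by positivity
      linarith
    have hs0 : 0 < s := (mul_pos hc hm0).trans_le hs'
    have hU : 0 < 2 * |D| + E := by positivity
    rw [mul_div_assoc', one_div, inv_mul_eq_div, div_le_div_iff₀ hc hs0]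
    by_cases hneg : ρ / 8 * |D| - 4 * E ≤ 0
    · have h1 : (ρ / 8 * |D| - 4 * E) * s ≤ 0 := mul_nonpos_of_nonpos_of_nonneg hneg hs0.le
      have h2 : 0 ≤ D * m * c := by
        have : 0 ≤ |D| ^ 2 / 2 := by positivity
        exact mul_nonneg (this.trans hDm) hc.le
      linarith
    · push Not at hneg
      calc (ρ / 8 * |D| - 4 * E) * s
          ≤ (ρ / 8 * |D|) * s := mul_le_mul_of_nonneg_right (by linarith) hs0.le
        _ ≤ (ρ / 8 * |D|) * (c / ρ * (2 * |D| + E)) :=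
            mul_le_mul_of_nonneg_left hs (by positivity)
        _ = (|D| * (2 * |D| + E) / 8) * c := by field_simp
        _ ≤ (|D| ^ 2 / 2) * c := by
            refine mul_le_mul_of_nonneg_right ?_ hc.le
            nlinarith
        _ ≤ D * m * c := mul_le_mul_of_nonneg_right hDm hc.le

/-! ### Coordinate-wise smooth functions -/

theorem linfNorm_nonneg {d : ℕ} (v : Fin d → ℝ) : 0 ≤ linfNorm v :=
  Real.iSup_nonneg fun _ ↦ abs_nonneg _

theorem abs_le_linfNorm {d : ℕ} (v : Fin d → ℝ) (j : Fin d) : |v j| ≤ linfNorm v :=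
  le_ciSup (f := fun j ↦ |v j|) (Set.finite_range _).bddAbove j

theorem l1Norm_nonneg {d : ℕ} (v : Fin d → ℝ) : 0 ≤ l1Norm v :=
  Finset.sum_nonneg fun _ _ ↦ abs_nonneg _

theorem gradL1_nonneg {d : ℕ} (F : EuclideanSpace ℝ (Fin d) → ℝ) (x : EuclideanSpace ℝ (Fin d)) :
    0 ≤ gradL1 F x :=
  l1Norm_nonneg _

theorem EuclideanSpace.norm_le_sqrt_mul {d : ℕ} (x : EuclideanSpace ℝ (Fin d)) {r : ℝ}
    (hr : 0 ≤ r) (h : ∀ j, |x j| ≤ r) : ‖x‖ ≤ Real.sqrt d * r := by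
  rw [EuclideanSpace.norm_eq, Real.sqrt_le_left (by positivity), mul_pow,
    Real.sq_sqrt (Nat.cast_nonneg d)]
  calc ∑ j, ‖x j‖ ^ 2 ≤ ∑ _j : Fin d, r ^ 2 :=
        Finset.sum_le_sum fun j _ ↦ pow_le_pow_left₀ (norm_nonneg _) (h j) 2
    _ = d * r ^ 2 := by simp

section CoordSmooth

variable {d : ℕ} {F : EuclideanSpace ℝ (Fin d) → ℝ} {L₀ L₁ : Fin d → ℝ}

/-- The entries of `L₀` and `L₁` may be negative; this form has nonnegative coefficients, with a
single constant in front of the gradient. -/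
theorem CoordSmooth.abs_sub_le (hF : CoordSmooth F L₀ L₁) {x y : EuclideanSpace ℝ (Fin d)}
    (h : linfNorm L₁ * ‖x - y‖ ≤ 1) (j : Fin d) :
    |partialD F j y - partialD F j x| ≤
      (|L₀ j| / Real.sqrt d + linfNorm L₁ * |partialD F j x|) * ‖y - x‖ := by
  refine (hF.2 x y h j).trans (mul_le_mul_of_nonneg_right ?_ (norm_nonneg _))
  refine add_le_add (div_le_div_of_nonneg_right (le_abs_self _) (Real.sqrt_nonneg _)) ?_
  exact mul_le_mul_of_nonneg_right ((le_abs_self _).trans (abs_le_linfNorm _ _)) (abs_nonneg _)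

theorem CoordSmooth.continuous_partialD (hF : CoordSmooth F L₀ L₁) (j : Fin d) :
    Continuous (partialD F j) := by
  refine continuous_iff_continuousAt.2 fun x ↦ ?_
  have h1 : ∀ᶠ y in nhds x, linfNorm L₁ * ‖x - y‖ ≤ 1 := by
    have : Filter.Tendsto (fun y ↦ linfNorm L₁ * ‖x - y‖) (nhds x)
        (nhds (linfNorm L₁ * ‖x - x‖)) := by
      exact Continuous.tendsto (by fun_prop) x
    rw [sub_self, norm_zero, mul_zero] at this
    exact this.eventually (eventually_le_nhds zero_lt_one)
  have h2 : Filter.Tendsto (fun y ↦ (|L₀ j| / Real.sqrt d + linfNorm L₁ * |partialD F j x|) *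
      ‖y - x‖) (nhds x) (nhds 0) := by
    have : Filter.Tendsto (fun y ↦ (|L₀ j| / Real.sqrt d + linfNorm L₁ * |partialD F j x|) *
      ‖y - x‖) (nhds x)
        (nhds ((|L₀ j| / Real.sqrt d + linfNorm L₁ * |partialD F j x|) * ‖x - x‖)) :=
      Continuous.tendsto (by fun_prop) x
    simpa using this
  exact tendsto_iff_dist_tendsto_zero.2 (squeeze_zero' (.of_forall fun _ ↦ dist_nonneg)
    (h1.mono fun y hy ↦ hF.abs_sub_le hy j) h2)

theorem Differentiable.exists_sub_eq_sum_partialD (hF : Differentiable ℝ F)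
    (x y : EuclideanSpace ℝ (Fin d)) :
    ∃ z ∈ segment ℝ x y, F y - F x = ∑ j, partialD F j z * (y j - x j) := by
  obtain ⟨z, hz, h⟩ := domain_mvt (f := F) (s := Set.univ) (x := x) (y := y)
    (fun w _ ↦ (hF w).hasFDerivAt.hasFDerivWithinAt) convex_univ trivial trivial
  refine ⟨z, hz, ?_⟩
  rw [h, ← toDual_gradient, InnerProductSpace.toDual_apply_apply, PiLp.inner_apply]
  refine Finset.sum_congr rfl fun j _ ↦ ?_
  simp [partialD, mul_comm]

/-- The descent inequality for coordinate-wise smooth functions. -/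
theorem CoordSmooth.descent (hF : CoordSmooth F L₀ L₁) {x y : EuclideanSpace ℝ (Fin d)}
    {r q : ℝ} (hq : ‖y - x‖ ≤ q) (hqL : linfNorm L₁ * q ≤ 1)
    (hy : ∀ j, |y j - x j| ≤ r) :
    F y ≤ F x + ∑ j, partialD F j x * (y j - x j) +
      (l1Norm L₀ / Real.sqrt d + linfNorm L₁ * gradL1 F x) * q * r := by
  obtain ⟨z, hz, h⟩ := hF.1.exists_sub_eq_sum_partialD x y
  have hzx : ‖z - x‖ ≤ q := by
    obtain ⟨θ, ⟨hθ₀, hθ₁⟩, rfl⟩ := (segment_eq_image' ℝ x y).subset hz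
    rw [add_sub_cancel_left, norm_smul, Real.norm_of_nonneg hθ₀]
    exact (mul_le_of_le_one_left (norm_nonneg _) hθ₁).trans hq
  have hL := linfNorm_nonneg L₁
  have hj : ∀ j, partialD F j z * (y j - x j) ≤ partialD F j x * (y j - x j) +
      (|L₀ j| / Real.sqrt d + linfNorm L₁ * |partialD F j x|) * q * r := by
    intro j
    have h1 := hF.abs_sub_le (x := x) (y := z)
      ((mul_le_mul_of_nonneg_left (by rwa [norm_sub_rev]) hL).trans hqL) j
    have h2 : (partialD F j z - partialD F j x) * (y j - x j) ≤
        (|L₀ j| / Real.sqrt d + linfNorm L₁ * |partialD F j x|) * q * r := by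
      refine (le_abs_self _).trans ?_
      rw [abs_mul]
      refine mul_le_mul (h1.trans ?_) (hy j) (abs_nonneg _) ?_
      · exact mul_le_mul_of_nonneg_left hzx (by positivity)
      · have := (norm_nonneg _).trans hzx
        positivity
    linarith
  have hsum := Finset.sum_le_sum fun j (_ : j ∈ Finset.univ) ↦ hj j
  rw [Finset.sum_add_distrib, ← Finset.sum_mul, ← Finset.sum_mul, Finset.sum_add_distrib,
    ← Finset.sum_div, ← Finset.mul_sum] at hsum
  change _ ≤ _ + (l1Norm L₀ / Real.sqrt d + linfNorm L₁ * gradL1 F x) * q * r at hsum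
  linarith

/-- A smooth function bounded below has a small gradient where its value is nearly minimal. -/
theorem CoordSmooth.mul_gradL1_le (hF : CoordSmooth F L₀ L₁) (hd : 0 < d) {Fstar Δ r : ℝ}
    (hFs : ∀ x, Fstar ≤ F x) {x : EuclideanSpace ℝ (Fin d)} (hΔ : F x - Fstar ≤ Δ) (hr : 0 ≤ r)
    (hrL : linfNorm L₁ * (Real.sqrt d * r) ≤ 1 / 10) :
    9 / 10 * (r * gradL1 F x) ≤ Δ + l1Norm L₀ * r ^ 2 := by
  -- The test point is a sign-descent step of length `r` per coordinate: its first-order gain is `r`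
  -- times the `ℓ¹` norm of the gradient, and the value at `y` is still at least `Fstar`.
  set y : EuclideanSpace ℝ (Fin d) :=
    WithLp.toLp 2 fun j ↦ x j - r * SignType.sign (partialD F j x) with hy
  have hyj : ∀ j, y j - x j = -(r * SignType.sign (partialD F j x)) := fun j ↦ by simp [hy]
  have hyr : ∀ j, |y j - x j| ≤ r := by
    intro j
    rw [hyj, abs_neg, abs_mul, abs_of_nonneg hr]
    refine mul_le_of_le_one_right hr ?_
    rcases SignType.sign (partialD F j x) with _ | _ | _ <;> simp
  have hd' : 0 < Real.sqrt d := Real.sqrt_pos.2 (by exact_mod_cast hd)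
  have h := hF.descent (x := x) (y := y)
    (EuclideanSpace.norm_le_sqrt_mul (y - x) hr hyr) (hrL.trans (by norm_num)) hyr
  have hs : ∑ j, partialD F j x * (y j - x j) = -(r * gradL1 F x) := by
    rw [gradL1, l1Norm, Finset.mul_sum, ← Finset.sum_neg_distrib]
    refine Finset.sum_congr rfl fun j _ ↦ ?_
    rw [hyj, ← self_mul_sign]
    ring
  have e : (l1Norm L₀ / Real.sqrt d + linfNorm L₁ * gradL1 F x) * (Real.sqrt d * r) * r =
      l1Norm L₀ * r ^ 2 + linfNorm L₁ * (Real.sqrt d * r) * (r * gradL1 F x) := by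
    field_simp
  have h0 : 0 ≤ r * gradL1 F x := mul_nonneg hr (gradL1_nonneg _ _)
  have h1 := mul_le_mul_of_nonneg_right hrL h0
  rw [hs, e] at h
  linarith [hFs y]

end CoordSmooth

/-! ### The trajectory of generalized SignSGD -/

section Trajectory

variable {d : ℕ} {Ξ : Type*}

/-- The exponentially weighted average of the gradient noise in coordinate `j`. -/
noncomputable def momentumNoise (F : EuclideanSpace ℝ (Fin d) → ℝ)
    (gradf : EuclideanSpace ℝ (Fin d) → Ξ → EuclideanSpace ℝ (Fin d))
    (x₁ : EuclideanSpace ℝ (Fin d)) (β₁ β₂ η : ℝ) (j : Fin d) (ξ : ℕ → Ξ) : ℕ → ℝ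
  | 0 => 0
  | t + 1 => β₁ * momentumNoise F gradf x₁ β₁ β₂ η j ξ t + (1 - β₁) *
      (gradf (signSGDState gradf x₁ β₁ β₂ η ξ t).x (ξ (t + 1)) j -
        partialD F j (signSGDState gradf x₁ β₁ β₂ η ξ t).x)

variable {F : EuclideanSpace ℝ (Fin d) → ℝ} {L₀ L₁ : Fin d → ℝ}
  {gradf : EuclideanSpace ℝ (Fin d) → Ξ → EuclideanSpace ℝ (Fin d)}
  {x₁ : EuclideanSpace ℝ (Fin d)} {β₂ η : ℝ} {ξ : ℕ → Ξ}

/-- Adaptedness: it allows the state to be written as a function of finitely many samples,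
independent of the next one. -/
theorem signSGDState_congr {β₁ : ℝ} {ζ : ℕ → Ξ} {t : ℕ} (h : ∀ s ≤ t, ξ s = ζ s) :
    signSGDState gradf x₁ β₁ β₂ η ξ t = signSGDState gradf x₁ β₁ β₂ η ζ t := by
  induction t with
  | zero => rfl
  | succ t ih =>
    simp only [signSGDState]
    rw [ih fun s hs ↦ h s (by omega), h (t + 1) le_rfl]

theorem momentumNoise_congr {β₁ : ℝ} {j : Fin d} {ζ : ℕ → Ξ} {t : ℕ} (h : ∀ s ≤ t, ξ s = ζ s) :
    momentumNoise F gradf x₁ β₁ β₂ η j ξ t = momentumNoise F gradf x₁ β₁ β₂ η j ζ t := by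
  induction t with
  | zero => rfl
  | succ t ih =>
    simp only [momentumNoise]
    rw [ih fun s hs ↦ h s (by omega), h (t + 1) le_rfl,
      signSGDState_congr (ζ := ζ) fun s hs ↦ h s (by omega)]

theorem signSGDState_v_nonneg {β₁ : ℝ} (h₀ : 0 ≤ β₂) (h₁ : β₂ ≤ 1) (t : ℕ) (j : Fin d) :
    0 ≤ (signSGDState gradf x₁ β₁ β₂ η ξ t).v j := by
  induction t with
  | zero => exact le_rfl
  | succ t ih =>
    exact add_nonneg (mul_nonneg h₀ ih) (mul_nonneg (by linarith) (sq_nonneg _))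

/-- The newest summand of `v` already contains `(1 - β₂) * m ^ 2`. This caps the normalized step. -/
theorem sqrt_mul_abs_m_le_sqrt_v {β₁ : ℝ} (h₀ : 0 ≤ β₂) (h₁ : β₂ ≤ 1) (t : ℕ) (j : Fin d) :
    Real.sqrt (1 - β₂) * |(signSGDState gradf x₁ β₁ β₂ η ξ (t + 1)).m j| ≤
      Real.sqrt ((signSGDState gradf x₁ β₁ β₂ η ξ (t + 1)).v j) := by
  rw [← Real.sqrt_sq_eq_abs, ← Real.sqrt_mul (by linarith)]
  exact Real.sqrt_le_sqrt
    (le_add_of_nonneg_left (mul_nonneg h₀ (signSGDState_v_nonneg h₀ h₁ t j)))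

theorem signSGDState_x_succ {β₁ : ℝ} (t : ℕ) (j : Fin d) :
    (signSGDState gradf x₁ β₁ β₂ η ξ (t + 1)).x j - (signSGDState gradf x₁ β₁ β₂ η ξ t).x j =
      -(η * ((signSGDState gradf x₁ β₁ β₂ η ξ (t + 1)).m j /
        Real.sqrt ((signSGDState gradf x₁ β₁ β₂ η ξ (t + 1)).v j))) := by
  simp [signSGDState, signSGDStep]

theorem abs_signSGDState_x_succ_le {β₁ : ℝ} (h₀ : 0 ≤ β₂) (h₁ : β₂ < 1) (hη : 0 ≤ η) (t : ℕ)
    (j : Fin d) :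
    |(signSGDState gradf x₁ β₁ β₂ η ξ (t + 1)).x j -
      (signSGDState gradf x₁ β₁ β₂ η ξ t).x j| ≤ η / Real.sqrt (1 - β₂) := by
  have hc : 0 < Real.sqrt (1 - β₂) := Real.sqrt_pos.2 (by linarith)
  rw [signSGDState_x_succ, abs_neg, abs_mul, abs_of_nonneg hη, div_eq_mul_inv η]
  refine mul_le_mul_of_nonneg_left ?_ hη
  rw [abs_div, abs_of_nonneg (Real.sqrt_nonneg _)]
  refine div_le_of_le_mul₀ (Real.sqrt_nonneg _) (by positivity) ?_
  rw [inv_mul_eq_div, le_div_iff₀ hc, mul_comm]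
  exact sqrt_mul_abs_m_le_sqrt_v h₀ h₁.le t j

/-- One step decreases the objective, up to the accumulated momentum error. -/
theorem CoordSmooth.signSGD_step_le (hF : CoordSmooth F L₀ L₁) (hd : 0 < d) {α ρ : ℝ}
    (hα₀ : 0 < α) (hα₁ : α ≤ 1) (hβ₂ : 0 ≤ β₂) (hβ₂' : β₂ < 1) (hρ₀ : 0 < ρ) (hρ₁ : ρ ≤ 1)
    (hρ : Real.sqrt β₂ = (1 - α) * (1 - ρ)) (hη : 0 ≤ η)
    (hL : linfNorm L₁ * (Real.sqrt d * (η / Real.sqrt (1 - β₂))) ≤ ρ * α / 10)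
    {N : Fin d → ℝ} {T : ℕ}
    (hN : ∀ j, ∀ t ≤ T, |momentumNoise F gradf x₁ (1 - α) β₂ η j ξ t| ≤ N j)
    {t : ℕ} (ht : t < T) :
    F (signSGDState gradf x₁ (1 - α) β₂ η ξ (t + 1)).x ≤
      F (signSGDState gradf x₁ (1 - α) β₂ η ξ t).x - η / Real.sqrt (1 - β₂) *
        (ρ / 40 * gradL1 F (signSGDState gradf x₁ (1 - α) β₂ η ξ t).x -
          (4 * (1 - α) ^ (t + 1) * gradL1 F x₁ +
            9 * (η * l1Norm L₀ / (Real.sqrt (1 - β₂) * α)) + 4 * ∑ j, N j)) := by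
  have hc : 0 < Real.sqrt (1 - β₂) := Real.sqrt_pos.2 (by linarith)
  have hd' : 0 < Real.sqrt d := Real.sqrt_pos.2 (by exact_mod_cast hd)
  have hΛ := linfNorm_nonneg L₁
  set S := signSGDState gradf x₁ (1 - α) β₂ η ξ with hS
  set c := Real.sqrt (1 - β₂) with hcdef
  set h := Real.sqrt d * (η / c) with hh
  have hh₀ : 0 ≤ h := by positivity
  have hL' : linfNorm L₁ * h ≤ α / 10 := hL.trans (by nlinarith)
  have hstep : ∀ t j, |(S (t + 1)).x j - (S t).x j| ≤ η / c :=
    abs_signSGDState_x_succ_le hβ₂ hβ₂' hη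
  have hnorm : ∀ t, ‖(S (t + 1)).x - (S t).x‖ ≤ h := fun t ↦
    EuclideanSpace.norm_le_sqrt_mul _ (by positivity) (hstep t)
  have hh1 : linfNorm L₁ * h ≤ 1 := by linarith
  set κ := 2 * h / α with hκ
  have hκ₀ : 0 ≤ κ := by positivity
  have hκh : α * κ = 2 * h := by rw [hκ]; field_simp
  have hκΛ : κ * linfNorm L₁ ≤ ρ / 5 := by
    have : α * (κ * linfNorm L₁) ≤ α * (ρ / 5) := by
      rw [← mul_assoc, hκh]; linarith
    exact le_of_mul_le_mul_left this hα₀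
  -- The tracking error without its part `κ * ‖L₁‖_∞ * |D|`, which `hκΛ` bounds by `ρ * |D| / 5`.
  set E : Fin d → ℕ → ℝ := fun j t ↦
    (1 - α) ^ (t + 1) * |partialD F j x₁| + κ * (|L₀ j| / Real.sqrt d) + N j with hE
  have hN₀ : ∀ j, 0 ≤ N j := fun j ↦ (abs_nonneg _).trans (hN j 0 (Nat.zero_le _))
  have hE₀ : ∀ j t, 0 ≤ E j t := by
    intro j t
    have := hN₀ j
    have : 0 ≤ 1 - α := by linarith
    positivity
  have hD : ∀ j t, |partialD F j (S t).x - partialD F j (S (t + 1)).x| ≤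
      (|L₀ j| / Real.sqrt d + linfNorm L₁ * |partialD F j (S (t + 1)).x|) * h := by
    intro j t
    refine (hF.abs_sub_le ((mul_le_mul_of_nonneg_left (hnorm t) hΛ).trans hh1) j).trans ?_
    rw [norm_sub_rev]
    exact mul_le_mul_of_nonneg_left (hnorm t) (by positivity)
  have hm : ∀ j, ∀ t < T, |(S (t + 1)).m j - partialD F j (S t).x| ≤
      E j t + ρ * |partialD F j (S t).x| / 5 := by
    intro j t ht
    -- By linearity, momentum minus averaged noise obeys the recursion driven by the true partial
    -- derivatives.
    have h1 := abs_momentum_sub_le (D := fun t ↦ partialD F j (S t).x)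
      (p := fun t ↦ (S t).m j - momentumNoise F gradf x₁ (1 - α) β₂ η j ξ t)
      hα₀.le hα₁ hh₀ (by positivity) hΛ hκ₀ hκh hL' (by simp [hS, signSGDState, momentumNoise])
      (by intro t; simp only [hS, signSGDState, signSGDStep, momentumNoise]; ring)
      (hD j) t
    have h2 := mul_le_mul_of_nonneg_right hκΛ (abs_nonneg (partialD F j (S t).x))
    have h3 := hN j (t + 1) ht
    have h4 := abs_add_le ((S (t + 1)).m j - momentumNoise F gradf x₁ (1 - α) β₂ η j ξ (t + 1) -
      partialD F j (S t).x) (momentumNoise F gradf x₁ (1 - α) β₂ η j ξ (t + 1))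
    rw [show (S (t + 1)).m j - momentumNoise F gradf x₁ (1 - α) β₂ η j ξ (t + 1) -
      partialD F j (S t).x + momentumNoise F gradf x₁ (1 - α) β₂ η j ξ (t + 1) =
      (S (t + 1)).m j - partialD F j (S t).x by ring] at h4
    have h5 : (S 0).x = x₁ := rfl
    simp only [h5] at h1
    simp only [hE]
    linarith
  have hm' : ∀ j, ∀ t < T, |(S (t + 1)).m j - partialD F j (S t).x| ≤
      E j t + |partialD F j (S t).x| / 5 := by
    intro j t ht
    have := mul_le_of_le_one_left (abs_nonneg (partialD F j (S t).x)) hρ₁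
    linarith [hm j t ht]
  have hgain : ∀ j, 1 / c * (ρ / 8 * |partialD F j (S t).x| - 4 * E j t) ≤
      partialD F j (S t).x * ((S (t + 1)).m j / Real.sqrt ((S (t + 1)).v j)) := by
    intro j
    refine normalized_gain hc hρ₀ hρ₁ (hE₀ j t) (hm' j t ht) ?_
      (sqrt_mul_abs_m_le_sqrt_v hβ₂ hβ₂'.le t j)
    exact sqrt_secondMoment_le (D := fun t ↦ partialD F j (S t).x) (m := fun t ↦ (S t).m j)
      (v := fun t ↦ (S t).v j) (E := E j) hα₀.le hα₁ hh₀ (by positivity) hκh hL' hβ₂ hβ₂'.le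
      hρ₀ hρ₁ hρ (hN₀ j) (fun t ↦ rfl) rfl (fun t ↦ rfl) (hD j) (hm' j) t ht
  have hdesc := hF.descent (x := (S t).x) (y := (S (t + 1)).x) (hnorm t) hh1 (hstep t)
  have hsum : ∑ j, partialD F j (S t).x * ((S (t + 1)).x j - (S t).x j) ≤
      -(η / c * (ρ / 8 * gradL1 F (S t).x - 4 * ((1 - α) ^ (t + 1) * gradL1 F x₁ +
        κ * (l1Norm L₀ / Real.sqrt d) + ∑ j, N j))) := by
    have h1 : ∀ j, partialD F j (S t).x * ((S (t + 1)).x j - (S t).x j) ≤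
        -(η / c * (ρ / 8 * |partialD F j (S t).x| - 4 * E j t)) := by
      intro j
      rw [hS, signSGDState_x_succ, ← hS]
      have := mul_le_mul_of_nonneg_left (hgain j) hη
      have e : η * (1 / c * (ρ / 8 * |partialD F j (S t).x| - 4 * E j t)) =
        η / c * (ρ / 8 * |partialD F j (S t).x| - 4 * E j t) := by ring
      linarith
    refine (Finset.sum_le_sum fun j _ ↦ h1 j).trans (le_of_eq ?_)
    rw [Finset.sum_neg_distrib, ← Finset.mul_sum, Finset.sum_sub_distrib, ← Finset.mul_sum,
      ← Finset.mul_sum]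
    simp only [hE, Finset.sum_add_distrib, ← Finset.mul_sum, ← Finset.sum_div]
    rfl
  have e1 : κ * (l1Norm L₀ / Real.sqrt d) = 2 * (η * l1Norm L₀ / (c * α)) := by
    rw [hκ, hh]; field_simp
  have e2 : (l1Norm L₀ / Real.sqrt d + linfNorm L₁ * gradL1 F (S t).x) * h * (η / c) =
      η / c * (η * l1Norm L₀ / c + linfNorm L₁ * h * gradL1 F (S t).x) := by
    rw [hh]; field_simp
  have h1 : η * l1Norm L₀ / c ≤ η * l1Norm L₀ / (c * α) :=
    div_le_div_of_nonneg_left (mul_nonneg hη (l1Norm_nonneg _)) (by positivity)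
      (mul_le_of_le_one_right hc.le hα₁)
  have h2 : linfNorm L₁ * h * gradL1 F (S t).x ≤ ρ / 10 * gradL1 F (S t).x := by
    refine mul_le_mul_of_nonneg_right ?_ (gradL1_nonneg _ _)
    refine hL.trans ?_
    nlinarith
  have h3 := mul_le_mul_of_nonneg_left (add_le_add h1 h2) (div_nonneg hη hc.le)
  rw [e1] at hsum
  rw [e2] at hdesc
  -- The constants: `ρ / 40 = ρ / 8 - ρ / 10`, the loss being the `L₁` part of the second-order
  -- term; `9 = 4 * 2 + 1`, from the lag and the `L₀` part of that term.
  have e3 : η / c * (ρ / 40 * gradL1 F (S t).x - (4 * (1 - α) ^ (t + 1) * gradL1 F x₁ +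
            9 * (η * l1Norm L₀ / (c * α)) + 4 * ∑ j, N j)) =
      η / c * (ρ / 8 * gradL1 F (S t).x - 4 * ((1 - α) ^ (t + 1) * gradL1 F x₁ +
        2 * (η * l1Norm L₀ / (c * α)) + ∑ j, N j)) -
      η / c * (η * l1Norm L₀ / (c * α) + ρ / 10 * gradL1 F (S t).x) := by ring
  rw [e3]
  linarith

theorem sum_pow_succ_le {β : ℝ} (h₀ : 0 ≤ β) (h₁ : β < 1) (T : ℕ) :
    ∑ t ∈ Finset.range T, β ^ (t + 1) ≤ 1 / (1 - β) := by
  have h := geom_sum_mul_neg β T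
  rw [le_div_iff₀ (by linarith), Finset.sum_congr rfl fun t _ ↦ pow_succ' β t, ← Finset.mul_sum,
    mul_assoc, h]
  have := pow_nonneg h₀ T
  nlinarith

/-- If the averaged noise is bounded, some iterate has a small gradient. -/
theorem CoordSmooth.exists_gradL1_le (hF : CoordSmooth F L₀ L₁) (hd : 0 < d)
    {Fstar Δ : ℝ} (hFs : ∀ x, Fstar ≤ F x) (hΔ : F x₁ - Fstar ≤ Δ) {α ρ : ℝ}
    (hα₀ : 0 < α) (hα₁ : α ≤ 1) (hβ₂ : 0 ≤ β₂) (hβ₂' : β₂ < 1) (hρ₀ : 0 < ρ) (hρ₁ : ρ ≤ 1)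
    (hρ : Real.sqrt β₂ = (1 - α) * (1 - ρ)) (hη : 0 < η)
    (hL : linfNorm L₁ * (Real.sqrt d * (η / Real.sqrt (1 - β₂))) ≤ ρ * α / 10)
    {N : Fin d → ℝ} {T : ℕ} (hT : 0 < T)
    (hN : ∀ j, ∀ t ≤ T, |momentumNoise F gradf x₁ (1 - α) β₂ η j ξ t| ≤ N j) :
    ∃ t < T, gradL1 F (signSGDState gradf x₁ (1 - α) β₂ η ξ t).x ≤
      40 / ρ * (Real.sqrt (1 - β₂) * Δ / (η * T) + 4 * (gradL1 F x₁ / (α * T)) +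
        9 * (η * l1Norm L₀ / (Real.sqrt (1 - β₂) * α)) + 4 * ∑ j, N j) := by
  have hc : 0 < Real.sqrt (1 - β₂) := Real.sqrt_pos.2 (by linarith)
  have hT' : (0 : ℝ) < T := by exact_mod_cast hT
  -- If every gradient exceeded the bound, the strict decreases would add up to more than `Δ` and
  -- push `F` below `Fstar`. The transient `(1 - α) ^ (t + 1)` sums to at most `1 / α`.
  by_contra! hcon
  set S := signSGDState gradf x₁ (1 - α) β₂ η ξ with hS
  set c := Real.sqrt (1 - β₂)
  set A := 9 * (η * l1Norm L₀ / (c * α)) + 4 * ∑ j, N j with hA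
  have hstep : ∀ t ∈ Finset.range T, F (S (t + 1)).x - F (S t).x <
      η / c * (4 * (1 - α) ^ (t + 1) * gradL1 F x₁ - c * Δ / (η * T) -
        4 * (gradL1 F x₁ / (α * T))) := by
    intro t ht
    have ht := Finset.mem_range.1 ht
    have h1 := hF.signSGD_step_le hd hα₀ hα₁ hβ₂ hβ₂' hρ₀ hρ₁ hρ hη.le hL hN ht
    have h2 := mul_lt_mul_of_pos_left (hcon t ht) (by positivity : 0 < ρ / 40)
    rw [← mul_assoc, show ρ / 40 * (40 / ρ) = 1 by field_simp, one_mul] at h2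
    have h3 : η / c * (c * Δ / (η * T) + 4 * (gradL1 F x₁ / (α * T)) -
        4 * (1 - α) ^ (t + 1) * gradL1 F x₁) < η / c * (ρ / 40 * gradL1 F (S t).x -
          (4 * (1 - α) ^ (t + 1) * gradL1 F x₁ + 9 * (η * l1Norm L₀ / (c * α)) +
            4 * ∑ j, N j)) :=
      mul_lt_mul_of_pos_left (by linarith) (by positivity)
    linarith
  have hsum := Finset.sum_lt_sum_of_nonempty (Finset.nonempty_range_iff.2 hT.ne') hstep
  have hpow := mul_le_mul_of_nonneg_left
    (sum_pow_succ_le (show 0 ≤ 1 - α by linarith) (by linarith) T) (gradL1_nonneg F x₁)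
  rw [Finset.sum_range_sub (fun t ↦ F (S t).x), ← Finset.mul_sum, Finset.sum_sub_distrib,
    Finset.sum_sub_distrib, ← Finset.sum_mul, ← Finset.mul_sum, Finset.sum_const,
    Finset.sum_const, Finset.card_range, nsmul_eq_mul, nsmul_eq_mul] at hsum
  have h1 : (T : ℝ) * (c * Δ / (η * T)) = c / η * Δ := by field_simp
  have h2 : (T : ℝ) * (4 * (gradL1 F x₁ / (α * T))) = 4 * (gradL1 F x₁ * (1 / (1 - (1 - α)))) := by
    rw [sub_sub_cancel]; field_simp
  rw [h1, h2] at hsum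
  have h3 : η / c * (4 * (∑ t ∈ Finset.range T, (1 - α) ^ (t + 1)) * gradL1 F x₁ - c / η * Δ -
      4 * (gradL1 F x₁ * (1 / (1 - (1 - α))))) ≤ η / c * (-(c / η * Δ)) :=
    mul_le_mul_of_nonneg_left (by linarith) (by positivity)
  have h4 : η / c * (-(c / η * Δ)) = -Δ := by field_simp
  have h5 : (S 0).x = x₁ := rfl
  rw [h5] at hsum
  linarith [hFs (S T).x]

end Trajectory

/-! ### Concentration of the averaged noise -/

/-- Conditionally on an independent past, bounded centred noise multiplies the exponential moment
by at most the factor of Hoeffding's lemma. -/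
theorem lintegral_exp_add_le {Ω A Ξ : Type*} [MeasurableSpace Ω] [MeasurableSpace A]
    [MeasurableSpace Ξ] {μ : Measure Ω} [IsProbabilityMeasure μ] {D : Measure Ξ}
    [IsProbabilityMeasure D] {P : Ω → A} {Z : Ω → Ξ} (hP : Measurable P) (hZ : Measurable Z)
    (hPZ : IndepFun P Z μ) (hD : μ.map Z = D) {f : A → ℝ} {φ : A → Ξ → ℝ} (hf : Measurable f)
    (hφ : Measurable (Function.uncurry φ)) {s : ℝ} (hφs : ∀ a, ∀ᵐ z ∂D, |φ a z| ≤ s)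
    (hφ₀ : ∀ a, ∫ z, φ a z ∂D = 0) (w : ℝ) :
    ∫⁻ ω, ENNReal.ofReal (Real.exp (f (P ω) + w * φ (P ω) (Z ω))) ∂μ ≤
      ENNReal.ofReal (Real.exp (w ^ 2 * s ^ 2 / 2)) *
        ∫⁻ ω, ENNReal.ofReal (Real.exp (f (P ω))) ∂μ := by
  have hmeas : Measurable fun q : A × Ξ ↦
      ENNReal.ofReal (Real.exp (f q.1 + w * φ q.1 q.2)) := by
    have : Measurable fun q : A × Ξ ↦ φ q.1 q.2 := hφ
    fun_prop
  have : IsProbabilityMeasure (μ.map P) := Measure.isProbabilityMeasure_map hP.aemeasurable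
  -- Independence replaces conditioning by an iterated integral, so that Hoeffding's lemma applies
  -- with the past `a` frozen.
  have hprod := (indepFun_iff_map_prod_eq_prod_map_map hP.aemeasurable hZ.aemeasurable).1 hPZ
  rw [hD] at hprod
  have hinner : ∀ a, ∫⁻ z, ENNReal.ofReal (Real.exp (f a + w * φ a z)) ∂D ≤
      ENNReal.ofReal (Real.exp (w ^ 2 * s ^ 2 / 2)) * ENNReal.ofReal (Real.exp (f a)) := by
    intro a
    have hφa : Measurable (φ a) := hφ.comp measurable_prodMk_left
    have hsub := hasSubgaussianMGF_of_mem_Icc_of_integral_eq_zero (a := -s) (b := s)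
      hφa.aemeasurable ((hφs a).mono fun z hz ↦ abs_le.1 hz) (hφ₀ a)
    have hle := hsub.mgf_le w
    rw [mgf] at hle
    have hcoe : (((‖s - -s‖₊ / 2) ^ 2 : NNReal) : ℝ) = s ^ 2 := by
      push_cast
      rw [Real.norm_eq_abs, div_pow, sq_abs]
      ring
    rw [hcoe] at hle
    have hm1 : Measurable fun z ↦ ENNReal.ofReal (Real.exp (w * φ a z)) := by fun_prop
    calc ∫⁻ z, ENNReal.ofReal (Real.exp (f a + w * φ a z)) ∂D
        = ENNReal.ofReal (Real.exp (f a)) * ∫⁻ z, ENNReal.ofReal (Real.exp (w * φ a z)) ∂D := by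
          rw [← lintegral_const_mul _ hm1]
          refine lintegral_congr fun z ↦ ?_
          rw [Real.exp_add, ENNReal.ofReal_mul (Real.exp_nonneg _)]
      _ = ENNReal.ofReal (Real.exp (f a)) *
          ENNReal.ofReal (∫ z, Real.exp (w * φ a z) ∂D) := by
          rw [ofReal_integral_eq_lintegral_ofReal (hsub.integrable_exp_mul w)
            (.of_forall fun _ ↦ Real.exp_nonneg _)]
      _ ≤ ENNReal.ofReal (Real.exp (f a)) * ENNReal.ofReal (Real.exp (w ^ 2 * s ^ 2 / 2)) := by
          gcongr
          exact hle.trans_eq (by ring_nf)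
      _ = _ := mul_comm _ _
  have hfm : Measurable fun a ↦ ENNReal.ofReal (Real.exp (f a)) := by fun_prop
  calc ∫⁻ ω, ENNReal.ofReal (Real.exp (f (P ω) + w * φ (P ω) (Z ω))) ∂μ
      = ∫⁻ q, ENNReal.ofReal (Real.exp (f q.1 + w * φ q.1 q.2)) ∂(μ.map fun ω ↦ (P ω, Z ω)) :=
        (lintegral_map hmeas (hP.prodMk hZ)).symm
    _ = ∫⁻ a, ∫⁻ z, ENNReal.ofReal (Real.exp (f a + w * φ a z)) ∂D ∂(μ.map P) := by
        rw [hprod, lintegral_prod _ hmeas.aemeasurable]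
    _ ≤ ∫⁻ a, ENNReal.ofReal (Real.exp (w ^ 2 * s ^ 2 / 2)) *
          ENNReal.ofReal (Real.exp (f a)) ∂(μ.map P) := lintegral_mono hinner
    _ = _ := by rw [lintegral_const_mul _ hfm, lintegral_map hfm hP]

/-- Chernoff's bound from a sub-Gaussian exponential moment. -/
theorem measure_abs_ge_le_of_lintegral_exp {Ω : Type*} [MeasurableSpace Ω] {μ : Measure Ω}
    {X : Ω → ℝ} (hX : Measurable X) {b a : ℝ} (hb : 0 < b) (ha : 0 ≤ a)
    (h : ∀ w : ℝ, ∫⁻ ω, ENNReal.ofReal (Real.exp (w * X ω)) ∂μ ≤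
      ENNReal.ofReal (Real.exp (w ^ 2 * b / 2))) :
    μ {ω | a ≤ |X ω|} ≤ ENNReal.ofReal (2 * Real.exp (-(a ^ 2 / (2 * b)))) := by
  -- Here `ε = ±1` selects the tail; `w = ε * (a / b)` is the optimal Chernoff parameter.
  have key : ∀ ε : ℝ, ε ^ 2 = 1 →
      μ {ω | a ≤ ε * X ω} ≤ ENNReal.ofReal (Real.exp (-(a ^ 2 / (2 * b)))) := by
    intro ε hε
    have hm : Measurable fun ω ↦ ENNReal.ofReal (Real.exp (ε * (a / b) * X ω)) := by fun_prop
    have h1 := mul_meas_ge_le_lintegral hm (μ := μ) (ENNReal.ofReal (Real.exp (a ^ 2 / b)))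
    have h2 : {ω | a ≤ ε * X ω} ⊆ {ω | ENNReal.ofReal (Real.exp (a ^ 2 / b)) ≤
        ENNReal.ofReal (Real.exp (ε * (a / b) * X ω))} := by
      intro ω hω
      refine ENNReal.ofReal_le_ofReal (Real.exp_le_exp.2 ?_)
      have := mul_le_mul_of_nonneg_left hω (by positivity : 0 ≤ a / b)
      calc a ^ 2 / b = a / b * a := by ring
        _ ≤ _ := this
        _ = _ := by ring
    have h3 := (mul_le_mul_right (measure_mono h2) _).trans (h1.trans (h _))
    have h4 : ENNReal.ofReal (Real.exp (-(a ^ 2 / b))) * ENNReal.ofReal (Real.exp (a ^ 2 / b)) =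
        1 := by
      rw [← ENNReal.ofReal_mul (Real.exp_nonneg _), ← Real.exp_add]
      simp
    calc μ {ω | a ≤ ε * X ω} = ENNReal.ofReal (Real.exp (-(a ^ 2 / b))) *
          (ENNReal.ofReal (Real.exp (a ^ 2 / b)) * μ {ω | a ≤ ε * X ω}) := by
          rw [← mul_assoc, h4, one_mul]
      _ ≤ ENNReal.ofReal (Real.exp (-(a ^ 2 / b))) *
          ENNReal.ofReal (Real.exp ((ε * (a / b)) ^ 2 * b / 2)) := by gcongr
      _ = ENNReal.ofReal (Real.exp (-(a ^ 2 / (2 * b)))) := by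
          rw [← ENNReal.ofReal_mul (Real.exp_nonneg _), ← Real.exp_add, mul_pow, hε]
          congr 2
          field_simp
          ring
  have hsub : {ω | a ≤ |X ω|} ⊆ {ω | a ≤ 1 * X ω} ∪ {ω | a ≤ -1 * X ω} := by
    intro ω hω
    rcases le_abs.1 (show a ≤ |X ω| from hω) with h | h
    · left; simpa using h
    · right; simpa using h
  calc μ {ω | a ≤ |X ω|} ≤ μ {ω | a ≤ 1 * X ω} + μ {ω | a ≤ -1 * X ω} :=
        (measure_mono hsub).trans (measure_union_le _ _)
    _ ≤ _ := add_le_add (key 1 (by norm_num)) (key (-1) (by norm_num))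
    _ = _ := by rw [← ENNReal.ofReal_add (by positivity) (by positivity), ← two_mul]

section Noise

variable {d : ℕ} {Ξ : Type*} [MeasurableSpace Ξ] {F : EuclideanSpace ℝ (Fin d) → ℝ}
  {gradf : EuclideanSpace ℝ (Fin d) → Ξ → EuclideanSpace ℝ (Fin d)}
  {x₁ : EuclideanSpace ℝ (Fin d)} {β₁ β₂ η : ℝ}

theorem measurable_signSGDState (hg : Measurable (Function.uncurry gradf)) (t : ℕ) :
    (Measurable fun ξ : ℕ → Ξ ↦ (signSGDState gradf x₁ β₁ β₂ η ξ t).x) ∧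
    (∀ j, Measurable fun ξ : ℕ → Ξ ↦ (signSGDState gradf x₁ β₁ β₂ η ξ t).m j) ∧
    ∀ j, Measurable fun ξ : ℕ → Ξ ↦ (signSGDState gradf x₁ β₁ β₂ η ξ t).v j := by
  induction t with
  | zero => exact ⟨measurable_const, fun _ ↦ measurable_const, fun _ ↦ measurable_const⟩
  | succ t ih =>
    obtain ⟨hx, hm, hv⟩ := ih
    have hg' : Measurable fun ξ : ℕ → Ξ ↦
        gradf (signSGDState gradf x₁ β₁ β₂ η ξ t).x (ξ (t + 1)) :=
      hg.comp (hx.prodMk (measurable_pi_apply (t + 1)))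
    have hgj : ∀ j, Measurable fun ξ : ℕ → Ξ ↦
        gradf (signSGDState gradf x₁ β₁ β₂ η ξ t).x (ξ (t + 1)) j := fun j ↦ by fun_prop
    have hm' : ∀ j, Measurable fun ξ : ℕ → Ξ ↦
        (signSGDState gradf x₁ β₁ β₂ η ξ (t + 1)).m j := fun j ↦
      ((hm j).const_mul _).add ((hgj j).const_mul _)
    have hv' : ∀ j, Measurable fun ξ : ℕ → Ξ ↦
        (signSGDState gradf x₁ β₁ β₂ η ξ (t + 1)).v j := fun j ↦
      ((hv j).const_mul _).add (((hm' j).pow_const 2).const_mul _)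
    refine ⟨?_, hm', hv'⟩
    refine (WithLp.measurable_toLp 2 (Fin d → ℝ)).comp (measurable_pi_lambda _ fun j ↦ ?_)
    have hxj : Measurable fun ξ : ℕ → Ξ ↦ (signSGDState gradf x₁ β₁ β₂ η ξ t).x j := by fun_prop
    exact hxj.sub (((hm' j).div (hv' j).sqrt).const_mul _)

theorem measurable_momentumNoise (hg : Measurable (Function.uncurry gradf)) {j : Fin d}
    (hF : Measurable (partialD F j)) (t : ℕ) :
    Measurable fun ξ : ℕ → Ξ ↦ momentumNoise F gradf x₁ β₁ β₂ η j ξ t := by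
  induction t with
  | zero => exact measurable_const
  | succ t ih =>
    have hx := (measurable_signSGDState (x₁ := x₁) (β₁ := β₁) (β₂ := β₂) (η := η) hg t).1
    have hg' : Measurable fun ξ : ℕ → Ξ ↦
        gradf (signSGDState gradf x₁ β₁ β₂ η ξ t).x (ξ (t + 1)) :=
      hg.comp (hx.prodMk (measurable_pi_apply (t + 1)))
    have hgj : Measurable fun ξ : ℕ → Ξ ↦
        gradf (signSGDState gradf x₁ β₁ β₂ η ξ t).x (ξ (t + 1)) j := by fun_prop
    exact (ih.const_mul _).add ((hgj.sub (hF.comp hx)).const_mul _)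

variable {D : Measure Ξ} [IsProbabilityMeasure D] {Ω : Type*} [MeasurableSpace Ω]
  {μ : Measure Ω} [IsProbabilityMeasure μ] {ξ : ℕ → Ω → Ξ}

theorem integral_noise_eq_zero (hg : Measurable (Function.uncurry gradf))
    (hu : ∀ x, ∫ z, gradf x z ∂D = gradient F x) {σ : Fin d → ℝ}
    (hσ : ∀ x j, ∀ᵐ z ∂D, |gradf x z j - partialD F j x| ≤ σ j)
    (x : EuclideanSpace ℝ (Fin d)) (j : Fin d) :
    ∫ z, (gradf x z j - partialD F j x) ∂D = 0 := by
  have hgx : Measurable (gradf x) := hg.comp measurable_prodMk_left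
  have hint : ∀ j, Integrable (fun z ↦ gradf x z j) D := by
    intro j
    have hm : Measurable fun z ↦ gradf x z j := by fun_prop
    refine Integrable.of_mem_Icc (partialD F j x - σ j) (partialD F j x + σ j) hm.aemeasurable ?_
    filter_upwards [hσ x j] with z hz
    have := abs_le.1 hz
    constructor <;> linarith
  rw [integral_sub (hint j) (integrable_const _), ← eval_integral_piLp hint, hu]
  simp [partialD]

/-- The exponential moments of the averaged noise are sub-Gaussian. -/
theorem lintegral_exp_momentumNoise_le (hg : Measurable (Function.uncurry gradf))
    (hu : ∀ x, ∫ z, gradf x z ∂D = gradient F x) {σ : Fin d → ℝ}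
    (hσ : ∀ x j, ∀ᵐ z ∂D, |gradf x z j - partialD F j x| ≤ σ j)
    (hF : ∀ j, Measurable (partialD F j)) (hξ : ∀ t, Measurable (ξ t))
    (hD : ∀ t, μ.map (ξ t) = D) (hind : iIndepFun ξ μ) {α : ℝ} (hα₀ : 0 ≤ α) (hα₁ : α ≤ 1)
    (j : Fin d) (t : ℕ) (w : ℝ) :
    ∫⁻ ω, ENNReal.ofReal (Real.exp
      (w * momentumNoise F gradf x₁ (1 - α) β₂ η j (fun s ↦ ξ s ω) t)) ∂μ ≤
      ENNReal.ofReal (Real.exp (w ^ 2 * (σ j ^ 2 * α) / 2)) := by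
  -- The past noise enters step `t + 1` with weight `w * (1 - α)`, so the hypothesis is needed for
  -- every `w`.
  induction t generalizing w with
  | zero =>
    simp only [momentumNoise, mul_zero, Real.exp_zero, ENNReal.ofReal_one, lintegral_const,
      measure_univ, mul_one]
    exact ENNReal.one_le_ofReal.2 (Real.one_le_exp (by positivity))
  | succ t ih =>
    obtain ⟨z₀⟩ : Nonempty Ξ := nonempty_of_isProbabilityMeasure D
    -- A history of the samples `0, …, t`, padded by an arbitrary `z₀`; the padding is invisible up
    -- to time `t`.
    let ext : (Finset.range (t + 1) → Ξ) → ℕ → Ξ := fun p i ↦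
      if h : i ∈ Finset.range (t + 1) then p ⟨i, h⟩ else z₀
    have hext : Measurable ext := by
      refine measurable_pi_lambda _ fun i ↦ ?_
      by_cases h : i ∈ Finset.range (t + 1)
      · simp only [ext, h, dif_pos]; exact measurable_pi_apply _
      · simp only [ext, h, dif_neg, not_false_iff]; exact measurable_const
    let P : Ω → Finset.range (t + 1) → Ξ := fun ω i ↦ ξ i ω
    have hP : Measurable P := measurable_pi_lambda _ fun i ↦ hξ i
    have hPZ : IndepFun P (ξ (t + 1)) μ := by
      have h := hind.indepFun_finset (Finset.range (t + 1)) {t + 1} (by simp) hξ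
      exact h.comp (ψ := fun p : ({t + 1} : Finset ℕ) → Ξ ↦ p ⟨t + 1, by simp⟩)
        measurable_id (measurable_pi_apply _)
    have hcongr : ∀ ω, ∀ s ≤ t, ext (P ω) s = ξ s ω := by
      intro ω s hs
      have : s ∈ Finset.range (t + 1) := by simp; omega
      simp only [ext, this, dif_pos, P]
    let f : (Finset.range (t + 1) → Ξ) → ℝ := fun p ↦
      w * (1 - α) * momentumNoise F gradf x₁ (1 - α) β₂ η j (ext p) t
    let φ : (Finset.range (t + 1) → Ξ) → Ξ → ℝ := fun p z ↦
      gradf (signSGDState gradf x₁ (1 - α) β₂ η (ext p) t).x z j -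
        partialD F j (signSGDState gradf x₁ (1 - α) β₂ η (ext p) t).x
    have hf : Measurable f := ((measurable_momentumNoise hg (hF j) t).comp hext).const_mul _
    have hx := (measurable_signSGDState (x₁ := x₁) (β₁ := 1 - α) (β₂ := β₂) (η := η) hg t).1
    have hφ : Measurable (Function.uncurry φ) := by
      have h1 : Measurable fun q : (Finset.range (t + 1) → Ξ) × Ξ ↦
          gradf (signSGDState gradf x₁ (1 - α) β₂ η (ext q.1) t).x q.2 :=
        hg.comp ((hx.comp (hext.comp measurable_fst)).prodMk measurable_snd)
      have h2 : Measurable fun q : (Finset.range (t + 1) → Ξ) × Ξ ↦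
          gradf (signSGDState gradf x₁ (1 - α) β₂ η (ext q.1) t).x q.2 j :=
        (measurable_pi_apply j).comp ((WithLp.measurable_ofLp 2 (Fin d → ℝ)).comp h1)
      exact h2.sub ((hF j).comp (hx.comp (hext.comp measurable_fst)))
    have key := lintegral_exp_add_le hP (hξ (t + 1)) hPZ (hD (t + 1)) hf hφ
      (fun a ↦ hσ _ j) (fun a ↦ integral_noise_eq_zero hg hu hσ _ j) (w * α)
    have e1 : ∀ ω, f (P ω) = w * (1 - α) *
        momentumNoise F gradf x₁ (1 - α) β₂ η j (fun s ↦ ξ s ω) t := fun ω ↦ by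
      simp only [f]
      rw [momentumNoise_congr (hcongr ω)]
    have e2 : ∀ ω, f (P ω) + w * α * φ (P ω) (ξ (t + 1) ω) =
        w * momentumNoise F gradf x₁ (1 - α) β₂ η j (fun s ↦ ξ s ω) (t + 1) := fun ω ↦ by
      rw [e1]
      simp only [φ, momentumNoise]
      rw [signSGDState_congr (hcongr ω)]
      ring
    simp only [e2] at key
    simp only [e1] at key
    refine key.trans ((mul_le_mul_right (ih (w * (1 - α))) _).trans ?_)
    rw [← ENNReal.ofReal_mul (Real.exp_nonneg _), ← Real.exp_add]
    refine ENNReal.ofReal_le_ofReal (Real.exp_le_exp.2 ?_)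
    -- The variance proxy `σ_j² α` is preserved by the recursion.
    have h1 : α ^ 2 + (1 - α) ^ 2 * α ≤ α := by nlinarith [mul_nonneg hα₀ (sub_nonneg.2 hα₁)]
    have h2 := mul_le_mul_of_nonneg_left h1 (by positivity : 0 ≤ w ^ 2 * σ j ^ 2 / 2)
    linarith

/-- With high probability the averaged noise is bounded throughout the first `T` steps. -/
theorem measure_momentumNoise_le (hg : Measurable (Function.uncurry gradf))
    (hu : ∀ x, ∫ z, gradf x z ∂D = gradient F x) {σ : Fin d → ℝ} (hσ₀ : ∀ j, 0 < σ j)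
    (hσ : ∀ x j, ∀ᵐ z ∂D, |gradf x z j - partialD F j x| ≤ σ j)
    (hF : ∀ j, Measurable (partialD F j)) (hξ : ∀ t, Measurable (ξ t))
    (hD : ∀ t, μ.map (ξ t) = D) (hind : iIndepFun ξ μ) {α : ℝ} (hα₀ : 0 < α) (hα₁ : α ≤ 1)
    {T : ℕ} {δ : ℝ} (hδ : 0 < δ) (hdT : δ ≤ 2 * (d * T)) :
    ENNReal.ofReal (1 - δ) ≤ μ {ω | ∀ j, ∀ t ≤ T,
      |momentumNoise F gradf x₁ (1 - α) β₂ η j (fun s ↦ ξ s ω) t| ≤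
        σ j * Real.sqrt (2 * α * Real.log (2 * (d * T) / δ))} := by
  set ℓ := Real.log (2 * (d * T) / δ) with hℓ
  have hdT₀ : (0 : ℝ) < d * T := by linarith
  have hℓ₀ : 0 ≤ ℓ := Real.log_nonneg (by rw [le_div_iff₀ hδ]; linarith)
  -- The threshold makes each two-sided tail `2 * exp (-ℓ) = δ / (d * T)`. Times start at `1`, since
  -- the noise at time `0` vanishes.
  let B : Fin d × ℕ → Set Ω := fun q ↦ {ω | σ q.1 * Real.sqrt (2 * α * ℓ) ≤
    |momentumNoise F gradf x₁ (1 - α) β₂ η q.1 (fun s ↦ ξ s ω) (q.2 + 1)|}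
  let I : Finset (Fin d × ℕ) := Finset.univ ×ˢ Finset.range T
  have hnm : ∀ j t, Measurable fun ω ↦
      momentumNoise F gradf x₁ (1 - α) β₂ η j (fun s ↦ ξ s ω) t := fun j t ↦
    (measurable_momentumNoise hg (hF j) t).comp (measurable_pi_lambda _ hξ)
  have hBm : ∀ q, MeasurableSet (B q) := fun q ↦
    measurableSet_le measurable_const (hnm _ _).abs
  have hB : ∀ q, μ (B q) ≤ ENNReal.ofReal (δ / (d * T)) := by
    intro q
    have hb : 0 < σ q.1 ^ 2 * α := by have := hσ₀ q.1; positivity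
    refine (measure_abs_ge_le_of_lintegral_exp (hnm _ _) hb
      (mul_nonneg (hσ₀ q.1).le (Real.sqrt_nonneg _))
      (lintegral_exp_momentumNoise_le hg hu hσ hF hξ hD hind hα₀.le hα₁ q.1 _)).trans ?_
    refine ENNReal.ofReal_le_ofReal (le_of_eq ?_)
    have hσne := (hσ₀ q.1).ne'
    have : (σ q.1 * Real.sqrt (2 * α * ℓ)) ^ 2 / (2 * (σ q.1 ^ 2 * α)) = ℓ := by
      rw [mul_pow, Real.sq_sqrt (by positivity)]
      field_simp
    rw [this, hℓ, Real.exp_neg, Real.exp_log (by positivity)]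
    field_simp
  have hunion : μ (⋃ q ∈ I, B q) ≤ ENNReal.ofReal δ := by
    refine (measure_biUnion_finset_le I B).trans ((Finset.sum_le_sum fun q _ ↦ hB q).trans ?_)
    rw [Finset.sum_const, nsmul_eq_mul, Finset.card_product, Finset.card_univ, Fintype.card_fin,
      Finset.card_range, ← ENNReal.ofReal_natCast, ← ENNReal.ofReal_mul (by positivity)]
    refine ENNReal.ofReal_le_ofReal (le_of_eq ?_)
    push_cast
    rw [mul_div_cancel₀ _ hdT₀.ne']
  have hcompl : (⋃ q ∈ I, B q)ᶜ ⊆ {ω | ∀ j, ∀ t ≤ T,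
      |momentumNoise F gradf x₁ (1 - α) β₂ η j (fun s ↦ ξ s ω) t| ≤
        σ j * Real.sqrt (2 * α * ℓ)} := by
    intro ω hω j t ht
    rcases t with _ | t
    · simp only [momentumNoise, abs_zero]
      exact mul_nonneg (hσ₀ j).le (Real.sqrt_nonneg _)
    · by_contra hcon
      refine hω (Set.mem_biUnion (x := (j, t)) ?_ (not_le.1 hcon).le)
      simp [I]; omega
  refine le_trans ?_ (measure_mono hcompl)
  rw [prob_compl_eq_one_sub (Finset.measurableSet_biUnion _ fun q _ ↦ hBm q),
    ENNReal.ofReal_sub _ hδ.le, ENNReal.ofReal_one]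
  exact tsub_le_tsub_left hunion _

end Noise

/-! ### The choice of parameters -/

/-- The step size is small compared with the averaging parameter. -/
theorem stepSize_le {d T : ℕ} {Δ Λ L s α β₂ ρ : ℝ} (hΔ : 0 < Δ) (hΛ : 0 ≤ Λ) (hL : 0 < L)
    (hs : 0 < s) (hT : 0 < T) (hβ₂ : β₂ < 1) (hρ : 0 < ρ)
    (hα : α = min (Real.sqrt L * Real.sqrt Δ / (s * Real.sqrt T)) 1)
    (hmax : max (100 * d * Δ * Λ ^ 2 / ((1 - β₂) * ρ ^ 2 * L))
      (10000 * d ^ 2 * Δ * s ^ 2 * Λ ^ 4 / ((1 - β₂) ^ 2 * ρ ^ 4 * L ^ 3)) ≤ (T : ℝ)) :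
    Λ * (Real.sqrt d * (Real.sqrt Δ / Real.sqrt L)) ≤
      ρ * Real.sqrt (1 - β₂) * (Real.sqrt α * Real.sqrt T) / 10 := by
  have hT' : (0 : ℝ) < T := by exact_mod_cast hT
  have hc : 0 < 1 - β₂ := by linarith
  have hα₀ : 0 ≤ α := by rw [hα]; positivity
  -- The claim is `X ≤ √α`. Each of the two lower bounds on `T` puts `X ^ 2` below one entry of the
  -- minimum defining `α`.
  set X := 10 * (Λ * (Real.sqrt d * (Real.sqrt Δ / Real.sqrt L))) /
    (ρ * Real.sqrt (1 - β₂) * Real.sqrt T) with hX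
  have hX₀ : 0 ≤ X := by positivity
  have hX2 : X ^ 2 = 100 * d * Δ * Λ ^ 2 / ((1 - β₂) * ρ ^ 2 * L) / T := by
    rw [hX]
    simp only [div_pow, mul_pow, Real.sq_sqrt hc.le, Real.sq_sqrt hΔ.le, Real.sq_sqrt hL.le,
      Real.sq_sqrt hT'.le, Real.sq_sqrt (Nat.cast_nonneg d)]
    field_simp
    ring
  have h1 : X ^ 2 ≤ 1 := by
    rw [hX2, div_le_one hT']
    exact (le_max_left _ _).trans hmax
  have h2 : X ^ 2 ≤ Real.sqrt L * Real.sqrt Δ / (s * Real.sqrt T) := by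
    refine (pow_le_pow_iff_left₀ (by positivity) (by positivity) two_ne_zero).1 ?_
    have h3 := (le_max_right _ _).trans hmax
    have h4 : (X ^ 2) ^ 2 = 10000 * d ^ 2 * Δ * s ^ 2 * Λ ^ 4 /
        ((1 - β₂) ^ 2 * ρ ^ 4 * L ^ 3) * (L * Δ / (s ^ 2 * T ^ 2)) := by
      rw [hX2]; field_simp; ring
    have h5 : (Real.sqrt L * Real.sqrt Δ / (s * Real.sqrt T)) ^ 2 =
        T * (L * Δ / (s ^ 2 * T ^ 2)) := by
      rw [div_pow, mul_pow, mul_pow, Real.sq_sqrt hL.le, Real.sq_sqrt hΔ.le,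
        Real.sq_sqrt hT'.le]
      field_simp
    rw [h4, h5]
    exact mul_le_mul_of_nonneg_right h3 (by positivity)
  have h3 : X ≤ Real.sqrt α := Real.le_sqrt_of_sq_le (hα ▸ le_min h2 h1)
  rw [hX, div_le_iff₀ (by positivity)] at h3
  linarith

/-- Such an `x` is a global minimizer: a sign step of small length `r` would gain order `r` and lose
only order `r ^ 2`. It settles the case `Δ = 0`. -/
theorem CoordSmooth.gradL1_eq_zero {d : ℕ} {F : EuclideanSpace ℝ (Fin d) → ℝ} {L₀ L₁ : Fin d → ℝ}
    (hF : CoordSmooth F L₀ L₁) (hd : 0 < d) {Fstar : ℝ} (hFs : ∀ x, Fstar ≤ F x)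
    {x : EuclideanSpace ℝ (Fin d)} (hx : F x - Fstar ≤ 0) : gradL1 F x = 0 := by
  by_contra hne
  have hG : 0 < gradL1 F x := lt_of_le_of_ne (gradL1_nonneg _ _) (Ne.symm hne)
  have hΛ := linfNorm_nonneg L₁
  have hL := l1Norm_nonneg L₀
  set a := linfNorm L₁ * Real.sqrt d with ha
  have ha₀ : 0 ≤ a := by positivity
  set r := min (1 / (10 * (a + 1))) (gradL1 F x / (2 * (l1Norm L₀ + 1))) with hr
  have hr₀ : 0 < r := by positivity
  have hr1 : a * r ≤ 1 / 10 := by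
    have : r * (10 * (a + 1)) ≤ 1 := by
      rw [← le_div_iff₀ (by positivity)]; exact min_le_left _ _
    nlinarith
  have hr2 : l1Norm L₀ * r ≤ gradL1 F x / 2 := by
    have : r * (2 * (l1Norm L₀ + 1)) ≤ gradL1 F x := by
      rw [← le_div_iff₀ (by positivity)]; exact min_le_right _ _
    nlinarith
  have h := hF.mul_gradL1_le hd hFs hx hr₀.le (by rw [← mul_assoc]; exact hr1)
  have h3 := mul_le_mul_of_nonneg_right hr2 hr₀.le
  have h4 : 0 < r * gradL1 F x := by positivity
  nlinarith

/-- The gradient at the initial point is bounded in terms of the initial gap. -/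
theorem CoordSmooth.gradL1_le {d : ℕ} {F : EuclideanSpace ℝ (Fin d) → ℝ} {L₀ L₁ : Fin d → ℝ}
    (hF : CoordSmooth F L₀ L₁) (hd : 0 < d) {Fstar Δ K : ℝ} (hFs : ∀ x, Fstar ≤ F x)
    {x : EuclideanSpace ℝ (Fin d)} (hx : F x - Fstar ≤ Δ) (hΔ : 0 < Δ) (hL : 0 < l1Norm L₀)
    (hK : linfNorm L₁ * (Real.sqrt d * (Real.sqrt Δ / Real.sqrt (l1Norm L₀))) ≤ K / 10)
    (hK₁ : 1 ≤ K) : gradL1 F x ≤ 3 * (Real.sqrt (l1Norm L₀) * Real.sqrt Δ * K) := by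
  have hK₀ : 0 < K := by linarith
  have hl : 0 < Real.sqrt (l1Norm L₀) := Real.sqrt_pos.2 hL
  have he : 0 < Real.sqrt Δ := Real.sqrt_pos.2 hΔ
  have hl2 : Real.sqrt (l1Norm L₀) ^ 2 = l1Norm L₀ := Real.sq_sqrt hL.le
  have he2 : Real.sqrt Δ ^ 2 = Δ := Real.sq_sqrt hΔ.le
  set l := Real.sqrt (l1Norm L₀)
  set e := Real.sqrt Δ
  -- The length `e / l` balances `Δ` against `‖L₀‖₁ r²`; dividing by `K` makes the step short enough
  -- for the smoothness condition.
  have h := hF.mul_gradL1_le hd hFs hx (r := e / l / K) (by positivity) (by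
    rw [show linfNorm L₁ * (Real.sqrt d * (e / l / K)) =
      linfNorm L₁ * (Real.sqrt d * (e / l)) / K by ring, div_le_iff₀ hK₀]
    linarith)
  rw [← hl2, ← he2] at h
  have e1 : l ^ 2 * (e / l / K) ^ 2 = e ^ 2 / K ^ 2 := by field_simp
  have e2 : e ^ 2 / K ^ 2 ≤ e ^ 2 := div_le_self (by positivity) (one_le_pow₀ hK₁)
  rw [e1] at h
  have e3 : e / l / K * gradL1 F x ≤ e / l / K * (3 * (l * e * K)) := by
    have : e / l / K * (3 * (l * e * K)) = 3 * e ^ 2 := by field_simp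
    rw [this]
    have := sq_nonneg e
    linarith
  exact le_of_mul_le_mul_left e3 (by positivity)

/-- All errors are compared with `y * (R / c)`: the factor `52 = 2 * (1 + 12 + 9) + 8` uses `y ≥ 1 /
2`, and `2080 = 40 * 52`. -/
theorem rate_le {R c ρ y B S : ℝ} (hR₀ : 0 < R) (hc : 0 < c) (hc₁ : c ≤ 1) (hρ₀ : 0 < ρ)
    (hy : 1 / 2 ≤ y) (hB : B ≤ 3 * R) (hS : S ≤ 2 * (y * R)) :
    40 / ρ * (c * R + 4 * B + 9 * (R / c) + 4 * S) ≤ 2080 * (y / (ρ * c) * R) := by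
  have hRc : 0 < R / c := by positivity
  have h6 : R ≤ R / c := le_div_self hR₀.le hc hc₁
  have h5 : c * R ≤ R / c := (mul_le_of_le_one_left hR₀.le hc₁).trans h6
  have h7 := mul_le_mul_of_nonneg_right hy hRc.le
  have h8 : y * R ≤ y * (R / c) := mul_le_mul_of_nonneg_left h6 (by linarith)
  calc _ ≤ 40 / ρ * (52 * (y * (R / c))) :=
        mul_le_mul_of_nonneg_left (by linarith) (by positivity)
    _ = _ := by field_simp; norm_num

set_option maxHeartbeats 400000 in
/-- The convergence rate in terms of the averaging parameter. -/
theorem CoordSmooth.measure_gradL1_le {d : ℕ} {F : EuclideanSpace ℝ (Fin d) → ℝ}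
    {Fstar : ℝ} {L₀ L₁ σ : Fin d → ℝ} {Ξ : Type*} [MeasurableSpace Ξ] {D : Measure Ξ}
    [IsProbabilityMeasure D] {gradf : EuclideanSpace ℝ (Fin d) → Ξ → EuclideanSpace ℝ (Fin d)}
    {Ω : Type*} [MeasurableSpace Ω] {μ : Measure Ω} [IsProbabilityMeasure μ] {ξ : ℕ → Ω → Ξ}
    {x₁ : EuclideanSpace ℝ (Fin d)} {T : ℕ} {δ Δ α β₂ ρ η : ℝ}
    (hF : CoordSmooth F L₀ L₁) (hd : 0 < d) (hFs : ∀ x, Fstar ≤ F x) (hL : 0 < l1Norm L₀)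
    (hg : Measurable (Function.uncurry gradf)) (hu : ∀ x, ∫ z, gradf x z ∂D = gradient F x)
    (hσ₀ : ∀ j, 0 < σ j) (hσ : ∀ x j, ∀ᵐ z ∂D, |gradf x z j - partialD F j x| ≤ σ j)
    (hξ : ∀ t, Measurable (ξ t)) (hD : ∀ t, μ.map (ξ t) = D) (hind : iIndepFun ξ μ)
    (hδ₀ : 0 < δ) (hδ₁ : δ < 1) (hT : 2 ≤ T) (hΔ : F x₁ - Fstar ≤ Δ) (hΔ₀ : 0 < Δ)
    (hα : α = min (Real.sqrt (l1Norm L₀) * Real.sqrt Δ / (l1Norm σ * Real.sqrt T)) 1)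
    (hβ₂ : 0 ≤ β₂) (hβ₂' : β₂ < 1) (hρ₀ : 0 < ρ) (hρ₁ : ρ ≤ 1)
    (hρ : Real.sqrt β₂ = (1 - α) * (1 - ρ))
    (hη : η = Real.sqrt (Δ * α) / (Real.sqrt (l1Norm L₀) * Real.sqrt T))
    (hmax : max (100 * d * Δ * linfNorm L₁ ^ 2 / ((1 - β₂) * ρ ^ 2 * l1Norm L₀))
      (10000 * d ^ 2 * Δ * l1Norm σ ^ 2 * linfNorm L₁ ^ 4 /
        ((1 - β₂) ^ 2 * ρ ^ 4 * l1Norm L₀ ^ 3)) ≤ (T : ℝ)) :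
    ENNReal.ofReal (1 - δ) ≤ μ {ω | ∃ t ∈ Finset.Icc 1 T,
      gradL1 F (signSGDIterate gradf x₁ (1 - α) β₂ η (fun s => ξ s ω) t) ≤
        2080 * (Real.sqrt (Real.log (d * T / δ)) / (ρ * Real.sqrt (1 - β₂)) *
          (Real.sqrt (l1Norm L₀) * Real.sqrt Δ / (Real.sqrt α * Real.sqrt T)))} := by
  have hd₁ : (1 : ℝ) ≤ d := by exact_mod_cast hd
  have hT₂ : (2 : ℝ) ≤ T := by exact_mod_cast hT
  have hT₀ : (0 : ℝ) < T := by linarith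
  have hs : 0 < l1Norm σ := by
    have : Nonempty (Fin d) := ⟨⟨0, hd⟩⟩
    exact Finset.sum_pos (fun j _ ↦ abs_pos.2 (hσ₀ j).ne') Finset.univ_nonempty
  have hα₀ : 0 < α := by rw [hα]; positivity
  have hα₁ : α ≤ 1 := hα ▸ min_le_right _ _
  have hdT₂ : (2 : ℝ) ≤ d * T := hT₂.trans (le_mul_of_one_le_left hT₀.le hd₁)
  have hdT : 2 ≤ d * T / δ := by
    rw [le_div_iff₀ hδ₀]
    linarith
  have hΛh := stepSize_le hΔ₀ (linfNorm_nonneg L₁) hL hs (by omega) hβ₂' hρ₀ hα hmax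
  set ℓ := Real.log (d * T / δ) with hℓ
  have hℓ₁ : 1 / 2 ≤ ℓ := by
    have := Real.log_le_log two_pos hdT
    have := Real.log_two_gt_d9
    linarith
  have hℓs : 1 / 2 ≤ Real.sqrt ℓ := Real.le_sqrt_of_sq_le (by linarith)
  have hlog : Real.log (2 * (d * T) / δ) ≤ 2 * ℓ := by
    rw [mul_div_assoc, Real.log_mul (by norm_num) (by positivity)]
    have := Real.log_le_log two_pos hdT
    linarith
  have hl : 0 < Real.sqrt (l1Norm L₀) := Real.sqrt_pos.2 hL
  have he : 0 < Real.sqrt Δ := Real.sqrt_pos.2 hΔ₀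
  have ha : 0 < Real.sqrt α := Real.sqrt_pos.2 hα₀
  have hq : 0 < Real.sqrt T := Real.sqrt_pos.2 hT₀
  have hc : 0 < Real.sqrt (1 - β₂) := Real.sqrt_pos.2 (by linarith)
  have hc₁ : Real.sqrt (1 - β₂) ≤ 1 := Real.sqrt_le_one.2 (by linarith)
  have hl2 : l1Norm L₀ = Real.sqrt (l1Norm L₀) ^ 2 := (Real.sq_sqrt hL.le).symm
  have he2 : Δ = Real.sqrt Δ ^ 2 := (Real.sq_sqrt hΔ₀.le).symm
  have ha2 : α = Real.sqrt α ^ 2 := (Real.sq_sqrt hα₀.le).symm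
  have hq2 : (T : ℝ) = Real.sqrt T ^ 2 := (Real.sq_sqrt hT₀.le).symm
  have hsα : l1Norm σ * Real.sqrt α ≤
      Real.sqrt (l1Norm L₀) * Real.sqrt Δ / (Real.sqrt α * Real.sqrt T) := by
    have h1 : α ≤ _ := hα ▸ min_le_left _ _
    rw [le_div_iff₀ (by positivity)] at h1 ⊢
    calc l1Norm σ * Real.sqrt α * (Real.sqrt α * Real.sqrt T)
        = Real.sqrt α ^ 2 * (l1Norm σ * Real.sqrt T) := by ring
      _ ≤ _ := by rwa [← ha2]
  have hη' : η = Real.sqrt Δ * Real.sqrt α / (Real.sqrt (l1Norm L₀) * Real.sqrt T) := by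
    rw [hη, Real.sqrt_mul hΔ₀.le]
  set l := Real.sqrt (l1Norm L₀) with hldef
  set e := Real.sqrt Δ with hedef
  set a := Real.sqrt α with hadef
  set q := Real.sqrt T with hqdef
  set c := Real.sqrt (1 - β₂) with hcdef
  set R := l * e / (a * q) with hR
  have hR₀ : 0 < R := by positivity
  have hρc : ρ * c ≤ 1 := mul_le_one₀ hρ₁ hc.le hc₁
  have hRR : R ≤ 2 * (Real.sqrt ℓ / (ρ * c) * R) := by
    have h1 : 1 / 2 ≤ Real.sqrt ℓ / (ρ * c) := by
      rw [le_div_iff₀ (by positivity)]; linarith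
    linarith [mul_le_mul_of_nonneg_right h1 hR₀.le]
  -- If `α * T ≤ 1`, the first iterate already meets the bound. Otherwise `K = √(α * T)` is
  -- admissible in `CoordSmooth.gradL1_le`, and the transient `‖∇F(x₁)‖₁ / (α * T)` is at most `3 *
  -- R`.
  rcases le_or_gt (a * q) 1 with haq | haq
  · have hx : gradL1 F x₁ ≤ 3 * (l * e * 1) := hF.gradL1_le hd hFs hΔ hΔ₀ hL
      (hΛh.trans (by
        have : ρ * c * (a * q) ≤ 1 := mul_le_one₀ hρc (by positivity) haq
        linarith)) le_rfl
    have hle : l * e ≤ R := le_div_self (by positivity) (by positivity) haq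
    have huniv : {ω | ∃ t ∈ Finset.Icc 1 T,
        gradL1 F (signSGDIterate gradf x₁ (1 - α) β₂ η (fun s => ξ s ω) t) ≤
          2080 * (Real.sqrt ℓ / (ρ * c) * R)} = Set.univ := by
      refine Set.eq_univ_of_forall fun ω ↦ ⟨1, by simp; omega, ?_⟩
      change gradL1 F x₁ ≤ _
      linarith
    rw [huniv, measure_univ]
    exact ENNReal.ofReal_le_one.2 (by linarith)
  have hx : gradL1 F x₁ ≤ 3 * (l * e * (a * q)) := hF.gradL1_le hd hFs hΔ hΔ₀ hL
    (hΛh.trans (by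
      have := mul_le_mul_of_nonneg_right hρc (by positivity : 0 ≤ a * q)
      linarith)) haq.le
  refine (measure_momentumNoise_le (x₁ := x₁) (β₂ := β₂) (η := η) hg hu hσ₀ hσ
    (fun j ↦ (hF.continuous_partialD j).measurable) hξ hD hind hα₀ hα₁ (T := T) hδ₀
    (by linarith)).trans (measure_mono fun ω hω ↦ ?_)
  have hη₀ : 0 < η := by rw [hη']; positivity
  obtain ⟨t, ht, h⟩ := hF.exists_gradL1_le hd hFs hΔ hα₀ hα₁ hβ₂ hβ₂' hρ₀ hρ₁ hρ hη₀ (by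
    rw [hη']
    calc linfNorm L₁ * (Real.sqrt d * (e * a / (l * q) / c))
        = linfNorm L₁ * (Real.sqrt d * (e / l)) * (a / (q * c)) := by field_simp
      _ ≤ ρ * c * (a * q) / 10 * (a / (q * c)) :=
          mul_le_mul_of_nonneg_right hΛh (by positivity)
      _ = ρ * a ^ 2 / 10 := by field_simp
      _ = ρ * α / 10 := by rw [← ha2]) (by omega : 0 < T) hω
  refine ⟨t + 1, by simp; omega, ?_⟩
  change gradL1 F (signSGDState gradf x₁ (1 - α) β₂ η (fun s => ξ s ω) t).x ≤ _
  refine h.trans ?_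
  have h1 : c * Δ / (η * T) = c * R := by
    rw [hη', he2, hq2, hR]; field_simp
  have h2 : gradL1 F x₁ / (α * T) ≤ 3 * R := by
    rw [div_le_iff₀ (by positivity)]
    refine hx.trans (le_of_eq ?_)
    rw [ha2, hq2, hR]; field_simp
  have h3 : η * l1Norm L₀ / (c * α) = R / c := by
    rw [hη', ha2, hl2, hR]; field_simp
  have h4 : ∑ j, σ j * Real.sqrt (2 * α * Real.log (2 * (d * T) / δ)) ≤
      2 * (Real.sqrt ℓ * R) := by
    have h5 : Real.sqrt (2 * α * Real.log (2 * (d * T) / δ)) ≤ 2 * a * Real.sqrt ℓ := by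
      refine Real.sqrt_le_iff.2 ⟨by positivity, ?_⟩
      rw [mul_pow, mul_pow, Real.sq_sqrt (by linarith : 0 ≤ ℓ), ← ha2]
      linarith [mul_le_mul_of_nonneg_left hlog hα₀.le]
    have h6 : ∑ j, σ j = l1Norm σ :=
      Finset.sum_congr rfl fun j _ ↦ (abs_of_pos (hσ₀ j)).symm
    rw [← Finset.sum_mul, h6]
    calc _ ≤ l1Norm σ * (2 * a * Real.sqrt ℓ) := mul_le_mul_of_nonneg_left h5 hs.le
      _ = 2 * (Real.sqrt ℓ * (l1Norm σ * a)) := by ring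
      _ ≤ _ := by gcongr
  rw [h1, h3]
  exact rate_le hR₀ hc hc₁ hρ₀ hℓs h2 h4

/-- The rate in terms of `α` is bounded by the two leading terms of the convergence bound. -/
theorem rate_le_leading_terms {Δ L s α c ρ ℓ τ : ℝ} (hΔ : 0 < Δ) (hL : 0 < L) (hs : 0 < s)
    (hτ : 0 < τ) (hα : α = min (Real.sqrt L * Real.sqrt Δ / (s * Real.sqrt τ)) 1)
    (hc : 0 < c) (hρ : 0 < ρ) (hα₁ : α = 1 → c = 1) (hℓ : 1 / 4 ≤ ℓ) :
    Real.sqrt ℓ / (ρ * c) * (Real.sqrt L * Real.sqrt Δ / (Real.sqrt α * Real.sqrt τ)) ≤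
      2 * (Real.sqrt ℓ * L ^ (1 / 4 : ℝ) * Δ ^ (1 / 4 : ℝ) * s ^ (1 / 2 : ℝ) /
        (ρ * c * τ ^ (1 / 4 : ℝ)) + ℓ * Real.sqrt (L * Δ) / (ρ * Real.sqrt τ)) := by
  have hℓ₀ : 0 < ℓ := by linarith
  have hA : 0 ≤ Real.sqrt ℓ * L ^ (1 / 4 : ℝ) * Δ ^ (1 / 4 : ℝ) * s ^ (1 / 2 : ℝ) /
    (ρ * c * τ ^ (1 / 4 : ℝ)) := by positivity
  have hB : 0 ≤ ℓ * Real.sqrt (L * Δ) / (ρ * Real.sqrt τ) := by positivity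
  -- In the first case the rate equals the `τ ^ (-1/4)` term. In the second, `α = c = 1` and `√ℓ ≤ 2
  -- * ℓ` leads to the `τ ^ (-1/2)` term.
  rcases min_choice (Real.sqrt L * Real.sqrt Δ / (s * Real.sqrt τ)) 1 with h | h
  · rw [h] at hα
    have hroot : ∀ {x : ℝ}, 0 < x → Real.sqrt x = x ^ (1 / 4 : ℝ) * x ^ (1 / 4 : ℝ) := by
      intro x hx
      rw [Real.sqrt_eq_rpow, ← Real.rpow_add hx]
      norm_num
    have hα₂ : Real.sqrt α = L ^ (1 / 4 : ℝ) * Δ ^ (1 / 4 : ℝ) /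
        (s ^ (1 / 2 : ℝ) * τ ^ (1 / 4 : ℝ)) := by
      rw [Real.sqrt_eq_iff_mul_self_eq (by rw [hα]; positivity) (by positivity), hα,
        hroot hL, hroot hΔ, hroot hτ]
      have : s = s ^ (1 / 2 : ℝ) * s ^ (1 / 2 : ℝ) := by
        rw [← Real.rpow_add hs]; norm_num
      generalize s ^ (1 / 2 : ℝ) = u at this
      subst this
      field_simp
    refine le_trans (le_of_eq ?_) (by linarith :
      Real.sqrt ℓ * L ^ (1 / 4 : ℝ) * Δ ^ (1 / 4 : ℝ) * s ^ (1 / 2 : ℝ) /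
        (ρ * c * τ ^ (1 / 4 : ℝ)) ≤ _)
    rw [hα₂, hroot hL, hroot hΔ, hroot hτ]
    field_simp
  · rw [h] at hα
    have hc₁ := hα₁ hα
    have hℓs : Real.sqrt ℓ ≤ 2 * ℓ := by
      refine Real.sqrt_le_iff.2 ⟨by linarith, ?_⟩
      have := mul_le_mul_of_nonneg_right hℓ hℓ₀.le
      linarith
    rw [hα, hc₁, Real.sqrt_one, one_mul, mul_one, ← Real.sqrt_mul hL.le]
    rw [hc₁, mul_one] at hA
    have : Real.sqrt ℓ / ρ * (Real.sqrt (L * Δ) / Real.sqrt τ) ≤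
        2 * ℓ / ρ * (Real.sqrt (L * Δ) / Real.sqrt τ) := by gcongr
    refine this.trans ?_
    have e : 2 * ℓ / ρ * (Real.sqrt (L * Δ) / Real.sqrt τ) =
      2 * (ℓ * Real.sqrt (L * Δ) / (ρ * Real.sqrt τ)) := by field_simp
    rw [e]
    linarith

/-! ### Degenerate cases and the final assembly. -/

theorem measure_eq_of_initial {d : ℕ} {F : EuclideanSpace ℝ (Fin d) → ℝ} {Ξ : Type*}
    {gradf : EuclideanSpace ℝ (Fin d) → Ξ → EuclideanSpace ℝ (Fin d)}
    {Ω : Type*} [MeasurableSpace Ω] {μ : Measure Ω} [IsProbabilityMeasure μ] {ξ : ℕ → Ω → Ξ}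
    {x₁ : EuclideanSpace ℝ (Fin d)} {T : ℕ} {δ β₁ β₂ η B : ℝ} (hT : 1 ≤ T) (hδ : 0 < δ)
    (hB : gradL1 F x₁ ≤ B) :
    ENNReal.ofReal (1 - δ) ≤ μ {ω | ∃ t ∈ Finset.Icc 1 T,
      gradL1 F (signSGDIterate gradf x₁ β₁ β₂ η (fun s => ξ s ω) t) ≤ B} := by
  have huniv : {ω | ∃ t ∈ Finset.Icc 1 T,
      gradL1 F (signSGDIterate gradf x₁ β₁ β₂ η (fun s => ξ s ω) t) ≤ B} = Set.univ :=
    Set.eq_univ_of_forall fun ω ↦ ⟨1, by simpa using hT, hB⟩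
  rw [huniv, measure_univ]
  exact ENNReal.ofReal_le_one.2 (by linarith)

theorem mainTheorem1 :
    ∃ C : ℝ, 0 < C ∧
      ∀ (d : ℕ) (F : EuclideanSpace ℝ (Fin d) → ℝ) (Fstar : ℝ) (L₀ L₁ σ : Fin d → ℝ)
        (Ξ : Type*) [MeasurableSpace Ξ] (D : Measure Ξ) [IsProbabilityMeasure D]
        (gradf : EuclideanSpace ℝ (Fin d) → Ξ → EuclideanSpace ℝ (Fin d))
        (Ω : Type*) [MeasurableSpace Ω] (μ : Measure Ω) [IsProbabilityMeasure μ]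
        (ξ : ℕ → Ω → Ξ)
        (x₁ : EuclideanSpace ℝ (Fin d)) (T : ℕ) (δ Δ α β₁ β₂ ρ η : ℝ),
        -- the objective: bounded below and coordinate-wise `(L₀, L₁)`-smooth
        (∀ x, Fstar ≤ F x) →
        CoordSmooth F L₀ L₁ →
        0 < l1Norm L₀ →
        -- the stochastic gradients: unbiased, with almost surely bounded noise
        Measurable (Function.uncurry gradf) →
        (∀ x, ∫ z, gradf x z ∂D = gradient F x) →
        (∀ j, 0 < σ j) →
        (∀ x j, ∀ᵐ z ∂D, |gradf x z j - partialD F j x| ≤ σ j) →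
        -- the samples: independent with law `D`
        (∀ t, Measurable (ξ t)) →
        (∀ t, μ.map (ξ t) = D) →
        iIndepFun ξ μ →
        -- the parameters
        0 < δ → δ < 1 → 1 ≤ T →
        F x₁ - Fstar ≤ Δ →
        α = min (Real.sqrt (l1Norm L₀) * Real.sqrt Δ / (l1Norm σ * Real.sqrt T)) 1 →
        β₁ = 1 - α →
        0 ≤ β₂ →
        -- `√β₂ / β₁ < 1`; for `β₂ = 0` also `β₁ = 0` is allowed, and then `ρ = 1`
        (β₂ = 0 ∨ Real.sqrt β₂ < β₁) →
        ρ = 1 - Real.sqrt β₂ / β₁ →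
        η = Real.sqrt (Δ * α) / (Real.sqrt (l1Norm L₀) * Real.sqrt T) →
        max (100 * d * Δ * linfNorm L₁ ^ 2 / ((1 - β₂) * ρ ^ 2 * l1Norm L₀))
            (10000 * d ^ 2 * Δ * l1Norm σ ^ 2 * linfNorm L₁ ^ 4 /
              ((1 - β₂) ^ 2 * ρ ^ 4 * l1Norm L₀ ^ 3)) ≤ (T : ℝ) →
        -- the bound for general `β₂`
        ((∀ j, BddAbove (sublevelPartials F x₁ j)) →
          ENNReal.ofReal (1 - δ) ≤ μ {ω | ∃ t ∈ Finset.Icc 1 T,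
            gradL1 F (signSGDIterate gradf x₁ β₁ β₂ η (fun s => ξ s ω) t) ≤
              C * (Real.sqrt (Real.log (d * T / δ)) * l1Norm L₀ ^ (1 / 4 : ℝ) *
                    Δ ^ (1 / 4 : ℝ) * l1Norm σ ^ (1 / 2 : ℝ) /
                    (ρ * Real.sqrt (1 - β₂) * (T : ℝ) ^ (1 / 4 : ℝ)) +
                  Real.log (d * T / δ) * Real.sqrt (l1Norm L₀ * Δ) / (ρ * Real.sqrt T)) +
              C * ((l1Norm (fun j => sSup (sublevelPartials F x₁ j)) + l1Norm σ) / ρ *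
                  decayFactor L₀ L₁ σ Δ β₂ T) +
              C * (gradL1 F x₁ / T)}) ∧
        -- the refined bound for `β₂ = 0`, which needs no bound on the gradients
        (β₂ = 0 →
          ENNReal.ofReal (1 - δ) ≤ μ {ω | ∃ t ∈ Finset.Icc 1 T,
            gradL1 F (signSGDIterate gradf x₁ β₁ β₂ η (fun s => ξ s ω) t) ≤
              C * (Real.sqrt (Real.log (d * T / δ)) * l1Norm L₀ ^ (1 / 4 : ℝ) *
                    Δ ^ (1 / 4 : ℝ) * l1Norm σ ^ (1 / 2 : ℝ) / (T : ℝ) ^ (1 / 4 : ℝ) +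
                  Real.log (d * T / δ) * Real.sqrt (l1Norm L₀ * Δ) / Real.sqrt T) +
              C * (gradL1 F x₁ / Real.sqrt T *
                    (1 / Real.sqrt T + l1Norm σ / Real.sqrt (l1Norm L₀ * Δ)) +
                  l1Norm σ / T)}) := by
  -- `4160 = 2 * 2080`, from `CoordSmooth.measure_gradL1_le` and `rate_le_leading_terms`.
  refine ⟨4160, by norm_num, ?_⟩
  intro d F Fstar L₀ L₁ σ Ξ _ D _ gradf Ω _ μ _ ξ x₁ T δ Δ α β₁ β₂ ρ η hFs hF hL hg hu hσ₀ hσ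
    hξ hD hind hδ₀ hδ₁ hT hΔ hα hβ₁ hβ₂ hβ hρ hη hmax
  have hd : 0 < d := by
    rcases Nat.eq_zero_or_pos d with rfl | h
    · simp [l1Norm] at hL
    · exact h
  have hs : 0 < l1Norm σ := by
    have : Nonempty (Fin d) := ⟨⟨0, hd⟩⟩
    exact Finset.sum_pos (fun j _ ↦ abs_pos.2 (hσ₀ j).ne') Finset.univ_nonempty
  have hα₀ : 0 ≤ α := by rw [hα]; positivity
  have hα₁ : α ≤ 1 := hα ▸ min_le_right _ _
  have hΔ₀ : 0 ≤ Δ := by linarith [hFs x₁]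
  have hd₁ : (1 : ℝ) ≤ d := by exact_mod_cast hd
  have hT₁ : (1 : ℝ) ≤ T := by exact_mod_cast hT
  have hℓ₀ : 0 ≤ Real.log (d * T / δ) := by
    refine Real.log_nonneg ?_
    rw [le_div_iff₀ hδ₀]
    linarith [one_le_mul_of_one_le_of_one_le hd₁ hT₁]
  have hβ₂' : β₂ < 1 := by
    rcases hβ with rfl | h
    · exact one_pos
    · by_contra! hcon
      linarith [Real.one_le_sqrt.2 hcon]
  have hρ₁ : ρ ≤ 1 := by
    have : 0 ≤ Real.sqrt β₂ / β₁ := div_nonneg (Real.sqrt_nonneg _) (by linarith)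
    linarith
  have hρ₀ : 0 < ρ := by
    rcases hβ with rfl | h
    · simp [hρ]
    · have : Real.sqrt β₂ / β₁ < 1 := (div_lt_one ((Real.sqrt_nonneg _).trans_lt h)).2 h
      linarith
  have hρβ : Real.sqrt β₂ = (1 - α) * (1 - ρ) := by
    rw [hρ, ← hβ₁, sub_sub_cancel]
    rcases hβ with rfl | h
    · simp
    · rw [mul_div_cancel₀ _ ((Real.sqrt_nonneg _).trans_lt h).ne']
  have hc : 0 < Real.sqrt (1 - β₂) := Real.sqrt_pos.2 (by linarith)
  subst hβ₁
  -- If `α = 1` then `β₁ = 0`, which excludes `√β₂ < β₁` and forces `β₂ = 0`.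
  have hcα : α = 1 → Real.sqrt (1 - β₂) = 1 := by
    rintro h
    rcases hβ with rfl | h'
    · simp
    · linarith [Real.sqrt_nonneg β₂]
  -- Common to both bounds. `T = 1` is separate because `log (d * T / δ)` has no positive lower
  -- bound when `d = T = 1`.
  have key : ∀ B : ℝ, 0 ≤ B → (T = 1 → gradL1 F x₁ ≤ B) →
      4160 * (Real.sqrt (Real.log (d * T / δ)) * l1Norm L₀ ^ (1 / 4 : ℝ) *
        Δ ^ (1 / 4 : ℝ) * l1Norm σ ^ (1 / 2 : ℝ) /
        (ρ * Real.sqrt (1 - β₂) * (T : ℝ) ^ (1 / 4 : ℝ)) +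
        Real.log (d * T / δ) * Real.sqrt (l1Norm L₀ * Δ) / (ρ * Real.sqrt T)) ≤ B →
      ENNReal.ofReal (1 - δ) ≤ μ {ω | ∃ t ∈ Finset.Icc 1 T,
        gradL1 F (signSGDIterate gradf x₁ (1 - α) β₂ η (fun s => ξ s ω) t) ≤ B} := by
    intro B hB₀ hB₁ hB
    rcases hT.eq_or_lt with h | hT₂
    · exact measure_eq_of_initial hT hδ₀ (hB₁ h.symm)
    rcases hΔ₀.eq_or_lt with h | hΔ₀
    · refine measure_eq_of_initial hT hδ₀ ?_
      rw [hF.gradL1_eq_zero hd hFs (hΔ.trans_eq h.symm)]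
      exact hB₀
    have hℓ : 1 / 4 ≤ Real.log (d * T / δ) := by
      have h2 : (2 : ℝ) ≤ T := by exact_mod_cast hT₂
      have h3 : (2 : ℝ) ≤ d * T := h2.trans (le_mul_of_one_le_left (by linarith) hd₁)
      have h4 : 2 ≤ d * T / δ := by
        rw [le_div_iff₀ hδ₀]
        linarith
      linarith [Real.log_le_log two_pos h4, Real.log_two_gt_d9]
    refine (hF.measure_gradL1_le hd hFs hL hg hu hσ₀ hσ hξ hD hind hδ₀ hδ₁ hT₂ hΔ hΔ₀ hα hβ₂
      hβ₂' hρ₀ hρ₁ hρβ hη hmax).trans (measure_mono ?_)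
    rintro ω ⟨t, ht, h⟩
    have hrate := rate_le_leading_terms hΔ₀ hL hs (by linarith : (0 : ℝ) < T) hα hc hρ₀ hcα hℓ
    exact ⟨t, ht, by linarith⟩
  have hG := gradL1_nonneg F x₁
  have hL₀ := hL.le
  have hσ₁ := hs.le
  have hlead : 0 ≤ Real.sqrt (Real.log (d * T / δ)) * l1Norm L₀ ^ (1 / 4 : ℝ) *
        Δ ^ (1 / 4 : ℝ) * l1Norm σ ^ (1 / 2 : ℝ) /
        (ρ * Real.sqrt (1 - β₂) * (T : ℝ) ^ (1 / 4 : ℝ)) +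
        Real.log (d * T / δ) * Real.sqrt (l1Norm L₀ * Δ) / (ρ * Real.sqrt T) := by positivity
  constructor
  · intro _
    have hdecay : 0 ≤ decayFactor L₀ L₁ σ Δ β₂ T := by
      unfold decayFactor
      split_ifs
      · exact le_rfl
      · exact Real.exp_nonneg _
    have hM : 0 ≤ (l1Norm (fun j => sSup (sublevelPartials F x₁ j)) + l1Norm σ) / ρ *
        decayFactor L₀ L₁ σ Δ β₂ T :=
      mul_nonneg (div_nonneg (add_nonneg (l1Norm_nonneg _) hσ₁) hρ₀.le) hdecay
    have hGT : 0 ≤ gradL1 F x₁ / T := by positivity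
    refine key _ (by positivity) (fun h ↦ ?_) (by linarith)
    have : gradL1 F x₁ / T = gradL1 F x₁ := by rw [h, Nat.cast_one, div_one]
    linarith
  · rintro rfl
    have hρ_one : ρ = 1 := by simp [hρ]
    simp only [hρ_one, sub_zero, Real.sqrt_one, one_mul] at key hlead
    have hrest : 0 ≤ gradL1 F x₁ / Real.sqrt T *
        (1 / Real.sqrt T + l1Norm σ / Real.sqrt (l1Norm L₀ * Δ)) + l1Norm σ / T := by positivity
    refine key _ (by positivity) (fun h ↦ ?_) (by linarith)
    have h1 : gradL1 F x₁ ≤ gradL1 F x₁ / Real.sqrt T *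
        (1 / Real.sqrt T + l1Norm σ / Real.sqrt (l1Norm L₀ * Δ)) + l1Norm σ / T := by
      simp only [h, Nat.cast_one, Real.sqrt_one, div_one]
      have : 0 ≤ gradL1 F x₁ * (l1Norm σ / Real.sqrt (l1Norm L₀ * Δ)) := by positivity
      linarith
    linarith
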